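/- Let $K$ be an algebraically closed field of characteristic zero. For a finite-dimensional Lie algebra $\mathfrak g$ over $K$, its index is $\operatorname{ind}\mathfrak g=\min_{f\in\mathfrak g^*}\dim\ker B_f$, where $B_f(x,y)=f([x,y])$. For compositions $\mathbf a=(a_1,\dots,a_m)$ and $\mathbf b=(b_1,\dots,b_l)$ of $n$, the seaweed algebra of type $\frac{a_1|\cdots|a_m}{b_1|\cdots|b_l}$ is the subalgebra of $\mathfrak{sl}(n,K)$ consisting of the trace-zero matrices that preserve all the subspaces $V_i=\operatorname{span}\{e_1,\dots,e_{a_1+\cdots+a_i}\}$ $(0\le i\le m)$ and $W_j=\operatorname{span}\{e_{b_1+\cdots+b_j+1},\dots,e_n\}$ $(0\le j\le l)$ of $K^n$, where $e_1,\dots,e_n$ is the standard basis. Let $C_{2,2}(n,k)$ be the number of ordered pairs of compositions $(a,b)$, $(c,d)$ of $n$ into two positive parts such that the seaweed algebra of type $\frac{a|b}{c|d}$ has index $k$. Then for all integers $t>1$ and $k\ge 0$, $$C_{2,2}(t+tk,k)=(t+tk-2)\,\varphi(t),$$ where $\varphi$ is Euler's totient function, and for $t=1$ and all integers $k\ge 0$,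 $$C_{2,2}(t+tk,k)=t+tk-1 .$$ -/

import Mathlib

open scoped Matrix

attribute [local instance 100] LieRing.ofAssociativeRing

/-- The Kirillov form `B_f(x, y) = f([x, y])` attached to a linear form `f` on a Lie algebra. -/
def kirillovForm {K L : Type*} [Field K] [LieRing L] [LieAlgebra K L] (f : Module.Dual K L) :
    L →ₗ[K] L →ₗ[K] K :=
  LinearMap.mk₂ K (fun x y => f ⁅x, y⁆)
    (fun x x' y => by rw [add_lie, map_add])
    (fun c x y => by rw [smul_lie, map_smul])
    (fun x y y' => by rw [lie_add, map_add])
    (fun c x y => by rw [lie_smul, map_smul])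

/-- The index of a (finite-dimensional) Lie algebra `L`: the minimum over all linear forms `f` on
`L` of the dimension of the kernel of the Kirillov form `B_f`. -/
noncomputable def lieIndex (K L : Type*) [Field K] [LieRing L] [LieAlgebra K L] : ℕ :=
  ⨅ f : Module.Dual K L, Module.finrank K (LinearMap.ker (kirillovForm f))

/-- The span of the first `m` standard basis vectors of `K ^ n`. -/
def headSpan (K : Type*) [Field K] (n m : ℕ) : Submodule K (Fin n → K) :=
  Submodule.span K {v | ∃ i : Fin n, (i : ℕ) < m ∧ v = Pi.single i 1}

/-- The span of the standard basis vectors of `K ^ n` other than the first `m`. -/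
def tailSpan (K : Type*) [Field K] (n m : ℕ) : Submodule K (Fin n → K) :=
  Submodule.span K {v | ∃ i : Fin n, m ≤ (i : ℕ) ∧ v = Pi.single i 1}

/-- The seaweed algebra of type `a₁|⋯|aₘ / b₁|⋯|bₗ`: the trace-zero matrices preserving
every `V_i`, spanned by the first `a₁ + ⋯ + aᵢ` standard basis vectors, and every `W_j`, spanned by
the standard basis vectors after the first `b₁ + ⋯ + bⱼ` ones. -/
def seaweed (K : Type*) [Field K] {n : ℕ} (a b : Composition n) :
    LieSubalgebra K (LieAlgebra.SpecialLinear.sl (Fin n) K) where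
  carrier := {A |
    (∀ i ≤ a.length, ∀ v ∈ headSpan K n (a.sizeUpTo i), A.1 *ᵥ v ∈ headSpan K n (a.sizeUpTo i)) ∧
    (∀ j ≤ b.length, ∀ v ∈ tailSpan K n (b.sizeUpTo j), A.1 *ᵥ v ∈ tailSpan K n (b.sizeUpTo j))}
  zero_mem' := by
    refine ⟨fun i _ v _ => ?_, fun j _ v _ => ?_⟩ <;> simp
  add_mem' := by
    rintro A B ⟨hA, hA'⟩ ⟨hB, hB'⟩
    refine ⟨fun i hi v hv => ?_, fun j hj v hv => ?_⟩
    · change (A.1 + B.1) *ᵥ v ∈ _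
      rw [Matrix.add_mulVec]
      exact Submodule.add_mem _ (hA i hi v hv) (hB i hi v hv)
    · change (A.1 + B.1) *ᵥ v ∈ _
      rw [Matrix.add_mulVec]
      exact Submodule.add_mem _ (hA' j hj v hv) (hB' j hj v hv)
  smul_mem' := by
    rintro c A ⟨hA, hA'⟩
    refine ⟨fun i hi v hv => ?_, fun j hj v hv => ?_⟩
    · change (c • A.1) *ᵥ v ∈ _
      rw [Matrix.smul_mulVec]
      exact Submodule.smul_mem _ _ (hA i hi v hv)
    · change (c • A.1) *ᵥ v ∈ _
      rw [Matrix.smul_mulVec]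
      exact Submodule.smul_mem _ _ (hA' j hj v hv)
  lie_mem' := by
    rintro A B ⟨hA, hA'⟩ ⟨hB, hB'⟩
    refine ⟨fun i hi v hv => ?_, fun j hj v hv => ?_⟩
    · change (A.1 * B.1 - B.1 * A.1) *ᵥ v ∈ _
      rw [Matrix.sub_mulVec, ← Matrix.mulVec_mulVec, ← Matrix.mulVec_mulVec]
      exact Submodule.sub_mem _ (hA i hi _ (hB i hi v hv)) (hB i hi _ (hA i hi v hv))
    · change (A.1 * B.1 - B.1 * A.1) *ᵥ v ∈ _
      rw [Matrix.sub_mulVec, ← Matrix.mulVec_mulVec, ← Matrix.mulVec_mulVec]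
      exact Submodule.sub_mem _ (hA' j hj _ (hB' j hj v hv)) (hB' j hj _ (hA' j hj v hv))

/-- `C₂,₂(n, k)`: the number of ordered pairs of compositions of `n` into two parts, that is, of
types `a|b / c|d` with `a + b = c + d = n`, whose seaweed algebra over `K` has index `k`. -/
noncomputable def seaweedCount22 (K : Type*) [Field K] (n k : ℕ) : ℕ :=
  {p : Composition n × Composition n |
    p.1.length = 2 ∧ p.2.length = 2 ∧ lieIndex K (seaweed K p.1 p.2) = k}.ncard

/-!
The index of the seaweed algebra of type `a|n-a / c|n-c` is `gcd(n, c - a) - 1`; the count follows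
from this formula. The reason is the meander of the seaweed: the reflections `σ` and `τ` of the
blocks of the two compositions are `i ↦ a - 1 - i` and `i ↦ c - 1 - i` modulo `n` (vertices
numbered from `0`), so `τ ∘ σ` is the rotation by `c - a`, which has `gcd(n, c - a)` orbits. The
components of the meander correspond to the orbits of `i ↦ a - 1 - i` on the residues modulo this
gcd.

The index is computed in the algebra `seaweedAlg` of all matrices, not only of trace zero, that
preserve the flags; this adds one to it (`finrank_ker_kirillovForm_add_one`). Functionals are
written `x ↦ tr (F x)`, and `stab a c F` is the kernel of the corresponding Kirillov form.

*Upper bound.* The functional `meanderMatrix` sums the entries on the arcs of the meander, an arc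
of a bottom block being weighted by its length. The kernel equations, applied twice, bound an
entry by one in another position with a factor smaller than one, because the outer of two nested
bottom arcs is the longer one. By a maximum argument over `ℚ` (to which the case of `K` is reduced
by `ℚ`-linear functionals), all entries vanish except those on the diagonal, on the arcs, and
those determined by the latter (`IsMeanderKernel.eq_zero_of_antidiag`). The diagonal is invariant
under both reflections, while the entries on the arcs form a flow that changes sign under them;
hence their sum, a function on the residues modulo the gcd, determines the element
(`finrank_stab_meanderMatrix_le`). The same argument shows that the kernel is block diagonal with
respect to the components (`apply_eq_zero_of_component_ne`).

*Lower bound.* For a functional that is block diagonal with respect to the components, each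
component contributes to the kernel its identity matrix, and a second dimension by parity if it
consists of two residues: then the reflections have no fixed points on it, its matrices form a
space of even dimension, and a skew form has even rank
(`rotGcd_le_finrank_stab_of_blockDiagonal`). As the kernel of the meander form is block diagonal,
the block diagonal functionals are transversal to the coadjoint orbit of the meander functional
(`exists_commutator_add_blockDiagonal`). So their conjugates pass through the meander functional
in all directions, and a minor vanishing on all of them vanishes identically
(`MvPolynomial.eq_zero_of_vanishes_on_curves`); this gives `rotGcd_le_finrank_stab`.

*Count.* In each row of the table of `gcd(n, c - a)`, `0 ≤ a, c < n`, the value `d ∣ n` occurs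
`φ(n / d)` times. Removing the row `a = 0` and the column `c = 0` gives the stated numbers.
-/

/-! ### The linear system of the meander form -/

/-- The reflection of the two blocks `[0, a)` and `[a, n)` of `{0, …, n - 1}`: it reverses each
block, and modulo `n` it is `i ↦ a - 1 - i`. -/
def blockFlip (n a i : ℕ) : ℕ := if i < a then a - 1 - i else n + a - 1 - i

/-- The positions `(i, j)` at which matrices of the seaweed algebra of type
`a|n-a / c|n-c` may be nonzero. -/
def Allowed (a c i j : ℕ) : Prop := (i < a ∨ a ≤ j) ∧ (c ≤ i ∨ j < c)

lemma blockFlip_spec {n a i : ℕ} (ha : a ≤ n) (hi : i < n) :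
    blockFlip n a i < n ∧ ((i < a ∧ blockFlip n a i + i + 1 = a) ∨
      (a ≤ i ∧ a ≤ blockFlip n a i ∧ blockFlip n a i + i + 1 = n + a)) := by
  unfold blockFlip
  split_ifs <;> omega

lemma blockFlip_blockFlip {n a i : ℕ} (ha : a ≤ n) (hi : i < n) :
    blockFlip n a (blockFlip n a i) = i := by
  have h1 := blockFlip_spec ha hi
  have h2 := blockFlip_spec ha h1.1
  omega

/-- The linear system satisfied by the entries `X i j` of a matrix in the kernel of the Kirillov
form of the meander functional. The arcs `{i, σ i}` of the top blocks carry the weight `1` and the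
arcs `{i, τ i}` of the bottom blocks carry their length as weight. -/
structure IsMeanderKernel {M : Type*} [AddCommGroup M] (n a c : ℕ) (X : ℕ → ℕ → M) : Prop where
  supp : ∀ i j, X i j ≠ 0 → i < n ∧ j < n ∧ Allowed a c i j
  eqn : ∀ i j, i < n → j < n → Allowed a c i j →
    (if j < blockFlip n a j then X (blockFlip n a j) i else 0) +
      (if blockFlip n c j < j then (j - blockFlip n c j) • X (blockFlip n c j) i else 0) =
    (if blockFlip n a i < i then X j (blockFlip n a i) else 0) +
      (if i < blockFlip n c i then (blockFlip n c i - i) • X j (blockFlip n c i) else 0)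

/-- A position below the diagonal, in a diagonal block of the top partition, whose row lies in the
second half of the block and whose column lies in the first half, off the antidiagonal. -/
def LowStraddle (n a r s : ℕ) : Prop :=
  s < r ∧ r < n ∧ (r < a ↔ s < a) ∧ s ≤ blockFlip n a s ∧ blockFlip n a r ≤ r ∧
    blockFlip n a r ≠ s

namespace IsMeanderKernel

variable {n a c : ℕ}

lemma eq_zero {M : Type*} [AddCommGroup M] {X : ℕ → ℕ → M} (h : IsMeanderKernel n a c X) {i j : ℕ}
    (hij : ¬ (i < n ∧ j < n ∧ Allowed a c i j)) : X i j = 0 := by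
  by_contra hne
  exact hij (h.supp i j hne)

/-- The contribution of the bottom arcs to the equation at `(i, j)`, `j < i`, is dominated by an
entry at a straddling position: this uses the equation at `(τ i, τ j)`, in which the outer one of
two nested arcs has the larger weight. -/
lemma exists_lt_of_bottom_ne_zero {X : ℕ → ℕ → ℚ} (ha : a ≤ n) (hc : c ≤ n)
    (h : IsMeanderKernel n a c X) {i j : ℕ} (hji : j < i) (hi : i < n) {C : ℚ}
    (hC : C = (if blockFlip n c j < j then (j - blockFlip n c j) • X (blockFlip n c j) i else 0) -
      (if i < blockFlip n c i then (blockFlip n c i - i) • X j (blockFlip n c i) else 0))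
    (hne : C ≠ 0) : ∃ r s, LowStraddle n a r s ∧ |C| < |X r s| := by
  have hj : j < n := hji.trans hi
  obtain ⟨ti, hti⟩ : ∃ t, t = blockFlip n c i := ⟨_, rfl⟩
  obtain ⟨tj, htj⟩ : ∃ t, t = blockFlip n c j := ⟨_, rfl⟩
  have si := blockFlip_spec hc hi
  have sj := blockFlip_spec hc hj
  have tti := blockFlip_blockFlip hc hi
  have ttj := blockFlip_blockFlip hc hj
  rw [← hti] at si tti hC
  rw [← htj] at sj ttj hC
  obtain ⟨si1, si2⟩ := si
  obtain ⟨sj1, sj2⟩ := sj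
  by_cases hb : (i < c ↔ j < c)
  · have hlt : ti < tj := by omega
    have E := h.eqn ti tj si1 sj1 (by unfold Allowed; omega)
    rw [tti, ttj] at E
    have ui := blockFlip_spec ha si1
    have uj := blockFlip_spec ha sj1
    have uui := blockFlip_blockFlip ha si1
    have uuj := blockFlip_blockFlip ha sj1
    obtain ⟨ui', hui'⟩ : ∃ t, t = blockFlip n a ti := ⟨_, rfl⟩
    obtain ⟨uj', huj'⟩ : ∃ t, t = blockFlip n a tj := ⟨_, rfl⟩
    rw [← hui'] at ui E uui
    rw [← huj'] at uj E uuj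
    obtain ⟨A, hA⟩ : ∃ A, A = (if tj < uj' then X uj' ti else 0) := ⟨_, rfl⟩
    obtain ⟨B, hB⟩ : ∃ B, B = (if ui' < ti then X tj ui' else 0) := ⟨_, rfl⟩
    rw [← hA, ← hB] at E
    have key : ∀ D : ℚ, D ≠ 0 → |D| < |A - B| →
        ∃ r s, LowStraddle n a r s ∧ |D| < |X r s| := by
      intro D hD hlt'
      by_cases hA0 : A = 0
      · have hB0 : B ≠ 0 := by
          rintro hB0
          rw [hA0, hB0] at hlt'
          simp at hlt'
          exact absurd hlt' (not_lt.2 (abs_nonneg _))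
        have hui : ui' < ti := by
          by_contra hcon
          rw [if_neg hcon] at hB
          exact hB0 hB
        rw [if_pos hui] at hB
        have hs := h.supp _ _ (hB ▸ hB0)
        unfold Allowed at hs
        refine ⟨tj, ui', ?_, ?_⟩
        · unfold LowStraddle
          rw [← huj', uui]
          omega
        · rw [hA0, zero_sub, abs_neg] at hlt'
          rwa [← hB]
      · have huj : tj < uj' := by
          by_contra hcon
          rw [if_neg hcon] at hA
          exact hA0 hA
        rw [if_pos huj] at hA
        have hs := h.supp _ _ (hA ▸ hA0)
        unfold Allowed at hs
        have hB0 : B = 0 := by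
          rw [hB, if_neg]
          omega
        refine ⟨uj', ti, ?_, ?_⟩
        · unfold LowStraddle
          rw [← hui', uuj]
          omega
        · rw [hB0, sub_zero] at hlt'
          rwa [← hA]
    have weigh : ∀ (p q : ℕ) (x D : ℚ), p < q → |D| = p * |x| → |A - B| = q * |x| → D ≠ 0 →
        |D| < |A - B| := by
      intro p q x D hpq hD hAB hD0
      have hx : 0 < |x| := by
        rw [abs_pos]
        rintro rfl
        simp at hD
        exact hD0 hD
      rw [hD, hAB]
      have : (p : ℚ) < q := by exact_mod_cast hpq
      nlinarith
    apply key C hne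
    rcases lt_or_ge tj j with h1 | h1
    · rw [if_pos h1, if_neg (by omega), sub_zero] at hC
      rw [if_neg (by omega), if_pos (by omega)] at E
      refine weigh (j - tj) (i - ti) (X tj i) C (by omega) ?_ ?_ hne
      · rw [hC, nsmul_eq_mul, abs_mul, Nat.abs_cast]
      · rw [show A - B = (i - ti) • X tj i by linarith, nsmul_eq_mul, abs_mul, Nat.abs_cast]
    · rw [if_neg (by omega)] at hC
      have h2 : i < ti := by
        by_contra hcon
        rw [if_neg hcon] at hC
        exact hne (by simpa using hC)
      rw [if_pos h2, zero_sub] at hC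
      rw [if_pos (by omega), if_neg (by omega)] at E
      refine weigh (ti - i) (tj - j) (X j ti) C (by omega) ?_ ?_ hne
      · rw [hC, abs_neg, nsmul_eq_mul, abs_mul, Nat.abs_cast]
      · rw [show A - B = -((tj - j) • X j ti) by linarith, abs_neg, nsmul_eq_mul, abs_mul,
          Nat.abs_cast]
  · exfalso
    have z1 : X tj i = 0 := h.eq_zero (by unfold Allowed; omega)
    have z2 : X j ti = 0 := h.eq_zero (by unfold Allowed; omega)
    rw [z1, z2] at hC
    simp at hC
    exact hne hC

lemma lowStraddle_eq_zero {X : ℕ → ℕ → ℚ} (ha : a ≤ n) (hc : c ≤ n)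
    (h : IsMeanderKernel n a c X) {r s : ℕ} (hrs : LowStraddle n a r s) : X r s = 0 := by
  classical
  -- A straddling entry of maximal absolute value would be dominated by another one.
  have step : ∀ r s, LowStraddle n a r s → X r s ≠ 0 →
      ∃ r' s', LowStraddle n a r' s' ∧ |X r s| < |X r' s'| := by
    intro r s hrs hne
    obtain ⟨h1, h2, h3, h4, h5, h6⟩ := hrs
    have hs : s < n := h1.trans h2
    have sr := blockFlip_spec ha h2
    have ss := blockFlip_spec ha hs
    have rr := blockFlip_blockFlip ha h2
    have sss := blockFlip_blockFlip ha hs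
    obtain ⟨r', hr'⟩ : ∃ t, t = blockFlip n a r := ⟨_, rfl⟩
    obtain ⟨s', hs'⟩ : ∃ t, t = blockFlip n a s := ⟨_, rfl⟩
    rw [← hr'] at sr rr h5 h6
    rw [← hs'] at ss sss h4
    rcases lt_or_gt_of_ne h6 with h7 | h7
    · have E := h.eqn s r' hs sr.1 (by unfold Allowed; omega)
      rw [rr, ← hs', if_pos (by omega), if_neg (c := s' < s) (by omega)] at E
      obtain ⟨u, v, huv, hlt⟩ := h.exists_lt_of_bottom_ne_zero ha hc h7 hs
        (C := -X r s) (by linarith) (neg_ne_zero.2 hne)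
      exact ⟨u, v, huv, by rwa [abs_neg] at hlt⟩
    · have E := h.eqn s' r ss.1 h2 (by unfold Allowed; omega)
      rw [sss, ← hr', if_neg (c := r < r') (by omega), if_pos (c := s < s') (by omega)] at E
      obtain ⟨u, v, huv, hlt⟩ := h.exists_lt_of_bottom_ne_zero ha hc (i := s') (j := r)
        (by omega) ss.1 (C := X r s) (by linarith) hne
      exact ⟨u, v, huv, hlt⟩
  have hsn : ∀ r s, LowStraddle n a r s → r < n ∧ s < n := fun r s h => ⟨h.2.1, h.1.trans h.2.1⟩
  obtain ⟨p, hp, hmax⟩ := Finset.exists_max_image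
    ((Finset.range n ×ˢ Finset.range n).filter fun p => LowStraddle n a p.1 p.2)
    (fun p => |X p.1 p.2|) ⟨(r, s), by simp [hrs, hsn r s hrs]⟩
  rw [Finset.mem_filter] at hp
  have h0 : X p.1 p.2 = 0 := by
    by_contra hne
    obtain ⟨r', s', h', hlt⟩ := step _ _ hp.2 hne
    have := hmax (r', s') (by simp [h', hsn r' s' h'])
    exact absurd hlt (not_lt.2 this)
  have := hmax (r, s) (by simp [hrs, hsn r s hrs])
  simp only [h0, abs_zero] at this
  exact abs_eq_zero.1 (le_antisymm this (abs_nonneg _))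

lemma flip_top_left_eq_zero {X : ℕ → ℕ → ℚ} (ha : a ≤ n) (hc : c ≤ n)
    (h : IsMeanderKernel n a c X) {i j : ℕ} (hij : i < j) (hj : j < n) (hf : j < blockFlip n a j) :
    X (blockFlip n a j) i = 0 := by
  have s1 := blockFlip_spec ha hj
  have s2 := blockFlip_spec ha (hij.trans hj)
  by_cases hb : (blockFlip n a j < a ↔ i < a)
  · apply h.lowStraddle_eq_zero ha hc
    unfold LowStraddle
    rw [blockFlip_blockFlip ha hj]
    omega
  · apply h.eq_zero
    unfold Allowed
    omega

lemma flip_top_right_eq_zero {X : ℕ → ℕ → ℚ} (ha : a ≤ n) (hc : c ≤ n)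
    (h : IsMeanderKernel n a c X) {i j : ℕ} (hij : i < j) (hj : j < n) (hf : blockFlip n a i < i) :
    X j (blockFlip n a i) = 0 := by
  have hi := hij.trans hj
  have s1 := blockFlip_spec ha hj
  have s2 := blockFlip_spec ha hi
  by_cases hb : (blockFlip n a i < a ↔ j < a)
  · apply h.lowStraddle_eq_zero ha hc
    unfold LowStraddle
    rw [blockFlip_blockFlip ha hi]
    omega
  · apply h.eq_zero
    unfold Allowed
    omega

lemma upStraddle_eq_zero {X : ℕ → ℕ → ℚ} (ha : a ≤ n) (hc : c ≤ n)
    (h : IsMeanderKernel n a c X) {p q : ℕ} (hpq : p < q) (hq : q < n) (hb : p < c ↔ q < c)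
    (h1 : p ≤ blockFlip n c p) (h2 : blockFlip n c q ≤ q) (h3 : blockFlip n c q ≠ p) :
    X p q = 0 := by
  have hp := hpq.trans hq
  have sp := blockFlip_spec hc hp
  have sq := blockFlip_spec hc hq
  have pp := blockFlip_blockFlip hc hp
  have qq := blockFlip_blockFlip hc hq
  obtain ⟨p', hp'⟩ : ∃ t, t = blockFlip n c p := ⟨_, rfl⟩
  obtain ⟨q', hq'⟩ : ∃ t, t = blockFlip n c q := ⟨_, rfl⟩
  rw [← hp'] at sp pp h1
  rw [← hq'] at sq qq h2 h3
  have fin : ∀ m : ℕ, m ≠ 0 → m • X p q = 0 → X p q = 0 := by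
    intro m hm hX
    exact (smul_eq_zero.1 hX).resolve_left hm
  rcases lt_or_gt_of_ne h3 with h4 | h4
  · have E := h.eqn q' p sq.1 hp (by unfold Allowed; omega)
    rw [qq, ← hp', if_neg (c := p' < p) (by omega), if_pos (c := q' < q) (by omega)] at E
    refine fin (q - q') (by omega) ?_
    have z1 : (if p < blockFlip n a p then X (blockFlip n a p) q' else 0) = 0 := by
      split_ifs with hf
      · exact h.flip_top_left_eq_zero ha hc h4 hp hf
      · rfl
    have z2 : (if blockFlip n a q' < q' then X p (blockFlip n a q') else 0) = 0 := by
      split_ifs with hf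
      · exact h.flip_top_right_eq_zero ha hc h4 hp hf
      · rfl
    linarith
  · have h5 : q < p' := by omega
    have E := h.eqn q p' hq sp.1 (by unfold Allowed; omega)
    rw [pp, ← hq', if_pos (c := p < p') (by omega), if_neg (c := q < q') (by omega)] at E
    refine fin (p' - p) (by omega) ?_
    have z1 : (if p' < blockFlip n a p' then X (blockFlip n a p') q else 0) = 0 := by
      split_ifs with hf
      · exact h.flip_top_left_eq_zero ha hc h5 sp.1 hf
      · rfl
    have z2 : (if blockFlip n a q < q then X p' (blockFlip n a q) else 0) = 0 := by
      split_ifs with hf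
      · exact h.flip_top_right_eq_zero ha hc h5 sp.1 hf
      · rfl
    linarith

lemma flip_bottom_left_eq_zero {X : ℕ → ℕ → ℚ} (ha : a ≤ n) (hc : c ≤ n)
    (h : IsMeanderKernel n a c X) {i j : ℕ} (hji : j < i) (hi : i < n) (hf : blockFlip n c j < j) :
    X (blockFlip n c j) i = 0 := by
  have hj := hji.trans hi
  have s1 := blockFlip_spec hc hj
  have s2 := blockFlip_spec hc hi
  by_cases hb : (blockFlip n c j < c ↔ i < c)
  · have jj := blockFlip_blockFlip hc hj
    apply h.upStraddle_eq_zero ha hc <;> omega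
  · apply h.eq_zero
    unfold Allowed
    omega

lemma flip_bottom_right_eq_zero {X : ℕ → ℕ → ℚ} (ha : a ≤ n) (hc : c ≤ n)
    (h : IsMeanderKernel n a c X) {i j : ℕ} (hji : j < i) (hi : i < n) (hf : i < blockFlip n c i) :
    X j (blockFlip n c i) = 0 := by
  have hj := hji.trans hi
  have s1 := blockFlip_spec hc hj
  have s2 := blockFlip_spec hc hi
  by_cases hb : (blockFlip n c i < c ↔ j < c)
  · have ii := blockFlip_blockFlip hc hi
    apply h.upStraddle_eq_zero ha hc <;> omega
  · apply h.eq_zero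
    unfold Allowed
    omega

/-- The equation at `(i, j)` with `j < i` involves the top arcs only. -/
lemma eqn_of_lt {X : ℕ → ℕ → ℚ} (ha : a ≤ n) (hc : c ≤ n)
    (h : IsMeanderKernel n a c X) {i j : ℕ} (hji : j < i) (hi : i < n) (hal : Allowed a c i j) :
    (if j < blockFlip n a j then X (blockFlip n a j) i else 0) =
      (if blockFlip n a i < i then X j (blockFlip n a i) else 0) := by
  have E := h.eqn i j hi (hji.trans hi) hal
  have z1 : (if blockFlip n c j < j then (j - blockFlip n c j) • X (blockFlip n c j) i else 0)
      = 0 := by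
    split_ifs with hf
    · rw [h.flip_bottom_left_eq_zero ha hc hji hi hf, smul_zero]
    · rfl
  have z2 : (if i < blockFlip n c i then (blockFlip n c i - i) • X j (blockFlip n c i) else 0)
      = 0 := by
    split_ifs with hf
    · rw [h.flip_bottom_right_eq_zero ha hc hji hi hf, smul_zero]
    · rfl
  linarith

/-- The equation at `(i, j)` with `i < j` involves the bottom arcs only. -/
lemma eqn_of_gt {X : ℕ → ℕ → ℚ} (ha : a ≤ n) (hc : c ≤ n)
    (h : IsMeanderKernel n a c X) {i j : ℕ} (hij : i < j) (hj : j < n) (hal : Allowed a c i j) :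
    (if blockFlip n c j < j then (j - blockFlip n c j) • X (blockFlip n c j) i else 0) =
      (if i < blockFlip n c i then (blockFlip n c i - i) • X j (blockFlip n c i) else 0) := by
  have E := h.eqn i j (hij.trans hj) hj hal
  have z1 : (if j < blockFlip n a j then X (blockFlip n a j) i else 0) = 0 := by
    split_ifs with hf
    · exact h.flip_top_left_eq_zero ha hc hij hj hf
    · rfl
  have z2 : (if blockFlip n a i < i then X j (blockFlip n a i) else 0) = 0 := by
    split_ifs with hf
    · exact h.flip_top_right_eq_zero ha hc hij hj hf
    · rfl
  linarith

/-- Below the diagonal and off the antidiagonals, entries are invariant under the top reflection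
unless they vanish. -/
lemma eq_flip_of_lower {X : ℕ → ℕ → ℚ} (ha : a ≤ n) (hc : c ≤ n)
    (h : IsMeanderKernel n a c X) {r s : ℕ} (hsr : s < r) (hne : X r s ≠ 0)
    (hanti : s ≠ blockFlip n a r) : X r s = X (blockFlip n a r) (blockFlip n a s) := by
  obtain ⟨hr, hs, hal⟩ := h.supp r s hne
  unfold Allowed at hal
  have sr := blockFlip_spec ha hr
  have ss := blockFlip_spec ha hs
  have rr := blockFlip_blockFlip ha hr
  have sss := blockFlip_blockFlip ha hs
  obtain ⟨r', hr'⟩ : ∃ t, t = blockFlip n a r := ⟨_, rfl⟩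
  obtain ⟨s', hs'⟩ : ∃ t, t = blockFlip n a s := ⟨_, rfl⟩
  have hns : ¬ LowStraddle n a r s := fun hl => hne (h.lowStraddle_eq_zero ha hc hl)
  unfold LowStraddle at hns
  rw [← hr'] at sr rr hanti hns ⊢
  rw [← hs'] at ss sss hns ⊢
  by_cases h1 : r < r'
  · have E := h.eqn_of_lt ha hc (i := s') (j := r) (by omega) ss.1 (by unfold Allowed; omega)
    rw [← hr', sss, if_pos (by omega), if_pos (by omega)] at E
    exact E.symm
  · have E := h.eqn_of_lt ha hc (i := s) (j := r') (by omega) hs (by unfold Allowed; omega)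
    rwa [← hs', rr, if_pos (by omega), if_pos (by omega)] at E

/-- Above the diagonal and off the antidiagonals, entries strictly increase in absolute value under
the bottom reflection unless they vanish. -/
lemma abs_lt_flip_of_upper {X : ℕ → ℕ → ℚ} (ha : a ≤ n) (hc : c ≤ n)
    (h : IsMeanderKernel n a c X) {p q : ℕ} (hpq : p < q) (hne : X p q ≠ 0)
    (hanti : q ≠ blockFlip n c p) : |X p q| < |X (blockFlip n c p) (blockFlip n c q)| := by
  obtain ⟨hp, hq, hal⟩ := h.supp p q hne
  unfold Allowed at hal
  have sp := blockFlip_spec hc hp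
  have sq := blockFlip_spec hc hq
  have pp := blockFlip_blockFlip hc hp
  have qq := blockFlip_blockFlip hc hq
  obtain ⟨p', hp'⟩ : ∃ t, t = blockFlip n c p := ⟨_, rfl⟩
  obtain ⟨q', hq'⟩ : ∃ t, t = blockFlip n c q := ⟨_, rfl⟩
  have hns : ¬ (p ≤ p' ∧ q' ≤ q ∧ q' ≠ p) := by
    rintro ⟨g1, g2, g3⟩
    rw [hp'] at g1
    rw [hq'] at g2 g3
    exact hne (h.upStraddle_eq_zero ha hc hpq hq (by omega) g1 g2 g3)
  rw [← hp'] at sp pp hanti ⊢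
  rw [← hq'] at sq qq ⊢
  have weigh : ∀ k m : ℕ, m < k → k • X p q = m • X p' q' → |X p q| < |X p' q'| := by
    intro k m hkm hX
    rw [nsmul_eq_mul, nsmul_eq_mul] at hX
    have hX' := congrArg abs hX
    rw [abs_mul, abs_mul, Nat.abs_cast, Nat.abs_cast] at hX'
    have : (m : ℚ) < k := by exact_mod_cast hkm
    have h0 : (0 : ℚ) ≤ m := Nat.cast_nonneg m
    have hpos : 0 < |X p q| := abs_pos.2 hne
    by_contra hcon
    push Not at hcon
    nlinarith [mul_le_mul_of_nonneg_left hcon h0, mul_lt_mul_of_pos_right this hpos]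
  by_cases h1 : q < q'
  · have E := h.eqn_of_gt ha hc (i := q) (j := p') (by omega) sp.1 (by unfold Allowed; omega)
    rw [← hq', pp, if_pos (by omega), if_pos (by omega)] at E
    exact weigh (p' - p) (q' - q) (by omega) E
  · have E := h.eqn_of_gt ha hc (i := q') (j := p) (by omega) hp (by unfold Allowed; omega)
    rw [← hp', qq, if_pos (by omega), if_pos (by omega)] at E
    exact weigh (q - q') (p - p') (by omega) E.symm

/-- On a set `Q` of positions stable under both reflections, off-diagonal entries vanish as soon as
those at the antidiagonal positions in `Q` do. -/
lemma eq_zero_of_antidiag_rat {X : ℕ → ℕ → ℚ} (ha : a ≤ n) (hc : c ≤ n)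
    (h : IsMeanderKernel n a c X) (Q : ℕ → ℕ → Prop)
    (hQa : ∀ i j, i < n → j < n → Q i j → Q (blockFlip n a i) (blockFlip n a j))
    (hQc : ∀ i j, i < n → j < n → Q i j → Q (blockFlip n c i) (blockFlip n c j))
    (ht : ∀ i, i < n → blockFlip n a i < i → Q i (blockFlip n a i) → X i (blockFlip n a i) = 0)
    (hb : ∀ i, i < n → i < blockFlip n c i → Q i (blockFlip n c i) → X i (blockFlip n c i) = 0)
    {r s : ℕ} (hrs : Q r s) (hne : r ≠ s) : X r s = 0 := by
  classical
  by_contra hX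
  obtain ⟨hr, hs, -⟩ := h.supp r s hX
  obtain ⟨⟨p, q⟩, hpq, hmax⟩ := Finset.exists_max_image
    ((Finset.range n ×ˢ Finset.range n).filter fun p => Q p.1 p.2 ∧ p.1 ≠ p.2)
    (fun p => |X p.1 p.2|) ⟨(r, s), by simp [hrs, hr, hs, hne]⟩
  have hpos : 0 < |X p q| := lt_of_lt_of_le (abs_pos.2 hX)
    (hmax (r, s) (by simp [hrs, hr, hs, hne]))
  simp only [Finset.mem_filter, Finset.mem_product, Finset.mem_range] at hpq hmax
  obtain ⟨⟨hp, hq⟩, hQ, hd⟩ := hpq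
  have upper : ∀ p q, p < n → q < n → Q p q → p < q → |X p q| = 0 ∨
      ∃ p' q', p' < n ∧ q' < n ∧ Q p' q' ∧ p' ≠ q' ∧ |X p q| < |X p' q'| := by
    intro p q hp hq hQ hlt
    by_cases h0 : X p q = 0
    · exact Or.inl (by rw [h0, abs_zero])
    by_cases hanti : q = blockFlip n c p
    · subst hanti
      exact Or.inl (by rw [hb p hp hlt hQ, abs_zero])
    · refine Or.inr ⟨_, _, (blockFlip_spec hc hp).1, (blockFlip_spec hc hq).1,
        hQc p q hp hq hQ, ?_, h.abs_lt_flip_of_upper ha hc hlt h0 hanti⟩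
      have hpp := blockFlip_blockFlip hc hp
      have hqq := blockFlip_blockFlip hc hq
      intro heq
      rw [heq] at hpp
      omega
  have contra : ∀ p' q', p' < n → q' < n → Q p' q' → p' < q' → |X p q| = |X p' q'| → False := by
    intro p' q' hp' hq' hQ' hlt heq
    rcases upper p' q' hp' hq' hQ' hlt with h0 | ⟨u, v, hu, hv, hQuv, huv, hl⟩
    · rw [heq, h0] at hpos
      exact lt_irrefl _ hpos
    · exact absurd (hmax (u, v) ⟨⟨hu, hv⟩, hQuv, huv⟩) (not_le.2 (heq ▸ hl))
  rcases lt_or_gt_of_ne hd with hlt | hlt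
  · exact contra p q hp hq hQ hlt rfl
  · have h0 : X p q ≠ 0 := abs_pos.1 hpos
    have hanti : q ≠ blockFlip n a p := by
      rintro rfl
      exact h0 (ht p hp hlt hQ)
    have e := h.eq_flip_of_lower ha hc hlt h0 hanti
    have hal := h.supp _ _ h0
    unfold Allowed at hal
    have sp := blockFlip_spec ha hp
    have sq := blockFlip_spec ha hq
    exact contra _ _ sp.1 sq.1 (hQa p q hp hq hQ) (by omega) (by rw [e])

end IsMeanderKernel

/-! ### Diagonal, flows, and the algebra of a seaweed -/

namespace IsMeanderKernel

variable {n a c : ℕ}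

lemma comp {M N : Type*} [AddCommGroup M] [AddCommGroup N] {X : ℕ → ℕ → M}
    (h : IsMeanderKernel n a c X) (φ : M →+ N) : IsMeanderKernel n a c fun i j => φ (X i j) where
  supp i j hij := h.supp i j (by rintro h0; exact hij (by rw [h0, map_zero]))
  eqn i j hi hj hal := by
    have := congrArg φ (h.eqn i j hi hj hal)
    simpa only [map_add, apply_ite φ, map_nsmul, map_zero] using this

lemma diag_top_rat {X : ℕ → ℕ → ℚ} (ha : a ≤ n) (hc : c ≤ n) (h : IsMeanderKernel n a c X)
    {i : ℕ} (hi : i < n) : X (blockFlip n a i) (blockFlip n a i) = X i i := by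
  have key : ∀ i, i < n → blockFlip n a i < i →
      X (blockFlip n a i) (blockFlip n a i) = X i i := by
    intro i hi hlt
    have si := blockFlip_spec ha hi
    have ii := blockFlip_blockFlip ha hi
    have E := h.eqn_of_lt ha hc hlt hi (by unfold Allowed; omega)
    rw [ii, if_pos hlt, if_pos hlt] at E
    exact E.symm
  have si := blockFlip_spec ha hi
  have ii := blockFlip_blockFlip ha hi
  rcases lt_trichotomy (blockFlip n a i) i with hlt | heq | hgt
  · exact key i hi hlt
  · rw [heq]
  · have := key _ si.1 (by omega)
    rw [ii] at this
    exact this.symm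

lemma diag_bottom_rat {X : ℕ → ℕ → ℚ} (ha : a ≤ n) (hc : c ≤ n) (h : IsMeanderKernel n a c X)
    {i : ℕ} (hi : i < n) : X (blockFlip n c i) (blockFlip n c i) = X i i := by
  have key : ∀ i, i < n → i < blockFlip n c i →
      X (blockFlip n c i) (blockFlip n c i) = X i i := by
    intro i hi hlt
    have si := blockFlip_spec hc hi
    have ii := blockFlip_blockFlip hc hi
    have E := h.eqn_of_gt ha hc hlt si.1 (by unfold Allowed; omega)
    rw [ii, if_pos hlt, if_pos hlt] at E
    rw [nsmul_eq_mul, nsmul_eq_mul] at E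
    exact (mul_left_cancel₀ (Nat.cast_ne_zero.2 (by omega)) E).symm
  have si := blockFlip_spec hc hi
  have ii := blockFlip_blockFlip hc hi
  rcases lt_trichotomy (blockFlip n c i) i with hlt | heq | hgt
  · have := key _ si.1 (by omega)
    rw [ii] at this
    exact this.symm
  · rw [heq]
  · exact key i hi hgt

end IsMeanderKernel

/-- Rational linear functionals separate the points of a field of characteristic zero. -/
lemma eq_of_forall_rat {K : Type*} [Field K] [CharZero K] {x y : K}
    (h : ∀ φ : K →+ ℚ, φ x = φ y) : x = y := by
  rw [← sub_eq_zero, ← Module.forall_dual_apply_eq_zero_iff ℚ]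
  intro φ
  rw [map_sub, sub_eq_zero]
  exact h φ.toAddMonoidHom

namespace IsMeanderKernel

variable {n a c : ℕ} {K : Type*} [Field K] [CharZero K] {X : ℕ → ℕ → K}

lemma eq_zero_of_antidiag (ha : a ≤ n) (hc : c ≤ n)
    (h : IsMeanderKernel n a c X) (Q : ℕ → ℕ → Prop)
    (hQa : ∀ i j, i < n → j < n → Q i j → Q (blockFlip n a i) (blockFlip n a j))
    (hQc : ∀ i j, i < n → j < n → Q i j → Q (blockFlip n c i) (blockFlip n c j))
    (ht : ∀ i, i < n → blockFlip n a i < i → Q i (blockFlip n a i) → X i (blockFlip n a i) = 0)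
    (hb : ∀ i, i < n → i < blockFlip n c i → Q i (blockFlip n c i) → X i (blockFlip n c i) = 0)
    {r s : ℕ} (hrs : Q r s) (hne : r ≠ s) : X r s = 0 := by
  apply eq_of_forall_rat
  intro φ
  rw [map_zero]
  refine (h.comp φ).eq_zero_of_antidiag_rat ha hc Q hQa hQc ?_ ?_ hrs hne
  · intro i h1 h2 h3
    rw [ht i h1 h2 h3, map_zero]
  · intro i h1 h2 h3
    rw [hb i h1 h2 h3, map_zero]

lemma diag_top (ha : a ≤ n) (hc : c ≤ n) (h : IsMeanderKernel n a c X)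
    {i : ℕ} (hi : i < n) : X (blockFlip n a i) (blockFlip n a i) = X i i :=
  eq_of_forall_rat fun φ => (h.comp φ).diag_top_rat ha hc hi

lemma diag_bottom (ha : a ≤ n) (hc : c ≤ n) (h : IsMeanderKernel n a c X)
    {i : ℕ} (hi : i < n) : X (blockFlip n c i) (blockFlip n c i) = X i i :=
  eq_of_forall_rat fun φ => (h.comp φ).diag_bottom_rat ha hc hi

end IsMeanderKernel

/-- The antidiagonal entry of `X` on the top arc at `i`, signed by the end of the arc at which `i`
lies. -/
def topFlow {M : Type*} [AddCommGroup M] (n a : ℕ) (X : ℕ → ℕ → M) (i : ℕ) : M :=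
  (if i < blockFlip n a i then X (blockFlip n a i) i else 0) -
    (if blockFlip n a i < i then X i (blockFlip n a i) else 0)

/-- The weighted antidiagonal entry of `X` on the bottom arc at `i`, signed by the end of the arc at
which `i` lies. -/
def bottomFlow {M : Type*} [AddCommGroup M] (n c : ℕ) (X : ℕ → ℕ → M) (i : ℕ) : M :=
  (if blockFlip n c i < i then (i - blockFlip n c i) • X (blockFlip n c i) i else 0) -
    (if i < blockFlip n c i then (blockFlip n c i - i) • X i (blockFlip n c i) else 0)

lemma topFlow_flip {M : Type*} [AddCommGroup M] {n a : ℕ} (ha : a ≤ n) (X : ℕ → ℕ → M) {i : ℕ}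
    (hi : i < n) : topFlow n a X (blockFlip n a i) = - topFlow n a X i := by
  unfold topFlow
  rw [blockFlip_blockFlip ha hi, neg_sub]

lemma bottomFlow_flip {M : Type*} [AddCommGroup M] {n c : ℕ} (hc : c ≤ n) (X : ℕ → ℕ → M) {i : ℕ}
    (hi : i < n) : bottomFlow n c X (blockFlip n c i) = - bottomFlow n c X i := by
  unfold bottomFlow
  rw [blockFlip_blockFlip hc hi, neg_sub]

/-- The equation at `(i, i)` is a conservation law. -/
lemma IsMeanderKernel.topFlow_add_bottomFlow {M : Type*} [AddCommGroup M] {n a c : ℕ}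
    {X : ℕ → ℕ → M} (h : IsMeanderKernel n a c X) {i : ℕ} (hi : i < n) :
    topFlow n a X i + bottomFlow n c X i = 0 := by
  have E := h.eqn i i hi hi (by unfold Allowed; omega)
  unfold topFlow bottomFlow
  rw [sub_add_sub_comm, E, sub_self]

/-- A function invariant under the rotation `τ ∘ σ` depends only on the residue modulo
`gcd n (c - a)`. -/
lemma eq_of_rotation_invariant {M : Type*} {n a c : ℕ} (ha : a ≤ n) (hc : c ≤ n) {w : ℕ → M}
    (hw : ∀ i < n, w (blockFlip n c (blockFlip n a i)) = w i) {i j : ℕ} (hi : i < n) (hj : j < n)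
    (hij : (i : ℤ) ≡ j [ZMOD (Int.gcd n ((c : ℤ) - a) : ℕ)]) : w i = w j := by
  have hn : (0 : ℤ) < n := by omega
  set W : ℤ → M := fun z => w (z % n).toNat with hW
  have hWn : Function.Periodic W n := fun z => by simp [hW]
  have hWd : Function.Periodic W ((c : ℤ) - a) := by
    intro z
    simp only [hW]
    have h0 := Int.emod_nonneg z hn.ne'
    have h1 := Int.emod_lt_of_pos z hn
    obtain ⟨m, hm⟩ : ∃ m : ℕ, (m : ℤ) = z % n := ⟨(z % n).toNat, Int.toNat_of_nonneg h0⟩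
    have hmn : m < n := by omega
    rw [← hm, Int.toNat_natCast, ← hw m hmn]
    congr 1
    have s1 := blockFlip_spec ha hmn
    have s2 := blockFlip_spec hc s1.1
    obtain ⟨p, hp⟩ : ∃ p, p = blockFlip n c (blockFlip n a m) := ⟨_, rfl⟩
    rw [← hp] at s2 ⊢
    have e : (z + ((c : ℤ) - a)) % n = (p : ℤ) % n := by
      have hz : z ≡ m [ZMOD n] := by
        rw [hm]
        exact (Int.mod_modEq z n).symm
      refine (hz.add_right _).trans (Int.modEq_iff_dvd.2 ?_)
      rcases s1.2 with ⟨-, h2⟩ | ⟨-, -, h2⟩ <;> rcases s2.2 with ⟨-, h3⟩ | ⟨-, -, h3⟩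
      · exact ⟨0, by omega⟩
      · exact ⟨1, by omega⟩
      · exact ⟨-1, by omega⟩
      · exact ⟨0, by omega⟩
    rw [e, Int.emod_eq_of_lt (by omega) (by omega), Int.toNat_natCast]
  have hWg : Function.Periodic W (Int.gcd n ((c : ℤ) - a) : ℕ) := by
    rw [Int.gcd_eq_gcd_ab, mul_comm, mul_comm ((c : ℤ) - a)]
    exact (hWn.int_mul _).add_period (hWd.int_mul _)
  obtain ⟨k, hk⟩ := hij.dvd
  have : W j = W i := by
    rw [show (j : ℤ) = i + k * (Int.gcd n ((c : ℤ) - a) : ℕ) by linarith]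
    exact hWg.int_mul k i
  simp only [hW] at this
  rw [Int.emod_eq_of_lt (by omega) (by omega), Int.emod_eq_of_lt (by omega) (by omega),
    Int.toNat_natCast, Int.toNat_natCast] at this
  exact this.symm

/-- The algebra of `n × n` matrices preserving the flags of a seaweed algebra of type
`a|n-a / c|n-c`. -/
def seaweedAlg (K : Type*) [Field K] (n a c : ℕ) : Subalgebra K (Matrix (Fin n) (Fin n) K) where
  carrier := {x | ∀ i j : Fin n, ¬ Allowed a c i j → x i j = 0}
  mul_mem' := by
    intro x y hx hy i j hij
    rw [Matrix.mul_apply]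
    refine Finset.sum_eq_zero fun k _ => ?_
    by_cases h1 : Allowed a c i k
    · rw [hy k j (by unfold Allowed at *; omega), mul_zero]
    · rw [hx i k h1, zero_mul]
  add_mem' := by
    intro x y hx hy i j hij
    rw [Matrix.add_apply, hx i j hij, hy i j hij, add_zero]
  algebraMap_mem' := by
    intro r i j hij
    rw [Matrix.algebraMap_matrix_apply, if_neg]
    rintro rfl
    apply hij
    unfold Allowed
    omega

lemma mem_seaweedAlg {K : Type*} [Field K] {n a c : ℕ} {x : Matrix (Fin n) (Fin n) K} :
    x ∈ seaweedAlg K n a c ↔ ∀ i j : Fin n, ¬ Allowed a c i j → x i j = 0 := Iff.rfl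

/-- The kernel of the Kirillov form of the functional `x ↦ tr (F x)` on `seaweedAlg K n a c`. -/
def stab {K : Type*} [Field K] {n : ℕ} (a c : ℕ) (F : Matrix (Fin n) (Fin n) K) :
    Submodule K (Matrix (Fin n) (Fin n) K) where
  carrier := {x | x ∈ seaweedAlg K n a c ∧
    ∀ y ∈ seaweedAlg K n a c, (F * (x * y - y * x)).trace = 0}
  add_mem' := by
    rintro x x' ⟨hx, hx1⟩ ⟨hx', hx1'⟩
    refine ⟨add_mem hx hx', fun y hy => ?_⟩
    rw [show F * ((x + x') * y - y * (x + x')) = F * (x * y - y * x) + F * (x' * y - y * x') by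
      noncomm_ring, Matrix.trace_add, hx1 y hy, hx1' y hy, add_zero]
  zero_mem' := ⟨zero_mem _, fun y _ => by simp⟩
  smul_mem' := by
    rintro r x ⟨hx, hx1⟩
    refine ⟨Subalgebra.smul_mem _ hx r, fun y hy => ?_⟩
    rw [smul_mul_assoc, mul_smul_comm, ← smul_sub, mul_smul_comm, Matrix.trace_smul, hx1 y hy,
      smul_zero]

lemma trace_mul_commutator {K : Type*} [Field K] {n : ℕ} (F x y : Matrix (Fin n) (Fin n) K) :
    (F * (x * y - y * x)).trace = ((F * x - x * F) * y).trace := by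
  rw [mul_sub, sub_mul, Matrix.trace_sub, Matrix.trace_sub, ← mul_assoc, ← mul_assoc,
    Matrix.trace_mul_comm (F * y) x, ← mul_assoc]

lemma single_mem_seaweedAlg {K : Type*} [Field K] {n a c : ℕ} {i j : Fin n}
    (h : Allowed a c i j) (r : K) : Matrix.single i j r ∈ seaweedAlg K n a c := by
  intro p q hpq
  rw [Matrix.single_apply, if_neg]
  rintro ⟨rfl, rfl⟩
  exact hpq h

lemma commutator_apply_of_mem_stab {K : Type*} [Field K] {n a c : ℕ}
    {F x : Matrix (Fin n) (Fin n) K} (hx : x ∈ stab a c F) {i j : Fin n} (h : Allowed a c i j) :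
    (F * x) j i = (x * F) j i := by
  have := hx.2 _ (single_mem_seaweedAlg h (1 : K))
  rw [trace_mul_commutator, Matrix.trace_mul_single, MulOpposite.op_one, one_smul] at this
  exact sub_eq_zero.1 this

/-! ### The kernel of the meander form -/

/-- The entries of a matrix, extended by zero to all pairs of natural numbers. -/
def entryNat {K : Type*} [Field K] {n : ℕ} (x : Matrix (Fin n) (Fin n) K) (i j : ℕ) : K :=
  if h : i < n ∧ j < n then x ⟨i, h.1⟩ ⟨j, h.2⟩ else 0

lemma entryNat_val {K : Type*} [Field K] {n : ℕ} (x : Matrix (Fin n) (Fin n) K) (i j : Fin n) :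
    entryNat x i j = x i j := by
  simp [entryNat]

lemma entryNat_of_lt {K : Type*} [Field K] {n : ℕ} (x : Matrix (Fin n) (Fin n) K) {i j : ℕ}
    (hi : i < n) (hj : j < n) : entryNat x i j = x ⟨i, hi⟩ ⟨j, hj⟩ := by
  simp [entryNat, hi, hj]

lemma entryNat_add {K : Type*} [Field K] {n : ℕ} (x y : Matrix (Fin n) (Fin n) K) (i j : ℕ) :
    entryNat (x + y) i j = entryNat x i j + entryNat y i j := by
  unfold entryNat
  split_ifs <;> simp

lemma entryNat_smul {K : Type*} [Field K] {n : ℕ} (r : K) (x : Matrix (Fin n) (Fin n) K)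
    (i j : ℕ) : entryNat (r • x) i j = r * entryNat x i j := by
  unfold entryNat
  split_ifs <;> simp

/-- The matrix `F` for which `x ↦ tr (F x)` is the meander functional: the sum of the entries of `x`
on the antidiagonals of the top blocks, below the diagonal, and of those on the antidiagonals of the
bottom blocks, above the diagonal, the latter weighted by the lengths of their arcs. -/
def meanderMatrix (K : Type*) [Field K] (n a c : ℕ) : Matrix (Fin n) (Fin n) K :=
  Matrix.of fun r s =>
    (if r < s ∧ (r : ℕ) = blockFlip n a s then 1 else 0) +
      (if s < r ∧ (r : ℕ) = blockFlip n c s then (((r : ℕ) - s : ℕ) : K) else 0)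

section

variable {K : Type*} [Field K] {n a c : ℕ}

lemma sum_ite_val_eq (f : Fin n → K) {m : ℕ} (hm : m < n) :
    ∑ k : Fin n, (if (k : ℕ) = m then f k else 0) = f ⟨m, hm⟩ := by
  rw [Finset.sum_eq_single ⟨m, hm⟩]
  · simp
  · intro b _ hb
    rw [if_neg]
    intro h
    exact hb (Fin.ext h)
  · simp

lemma meanderMatrix_mul_apply (ha : a ≤ n) (hc : c ≤ n) (x : Matrix (Fin n) (Fin n) K)
    (i j : Fin n) : (meanderMatrix K n a c * x) j i =
    (if j < blockFlip n a j then entryNat x (blockFlip n a j) i else 0) +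
      (if blockFlip n c j < j then (j - blockFlip n c j) • entryNat x (blockFlip n c j) i
        else 0) := by
  have sa := blockFlip_spec ha j.2
  have sc := blockFlip_spec hc j.2
  rw [Matrix.mul_apply, entryNat_of_lt x sa.1 i.2, entryNat_of_lt x sc.1 i.2]
  have e : ∀ k : Fin n, meanderMatrix K n a c j k * x k i =
      (if (k : ℕ) = blockFlip n a j then (if j < k then x k i else 0) else 0) +
      (if (k : ℕ) = blockFlip n c j then (if k < j then ((j : ℕ) - k : ℕ) • x k i else 0)
        else 0) := by
    intro k
    have h1 : (j : ℕ) = blockFlip n a k ↔ (k : ℕ) = blockFlip n a j := by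
      constructor <;> intro h
      · rw [h, blockFlip_blockFlip ha k.2]
      · rw [h, blockFlip_blockFlip ha j.2]
    have h2 : (j : ℕ) = blockFlip n c k ↔ (k : ℕ) = blockFlip n c j := by
      constructor <;> intro h
      · rw [h, blockFlip_blockFlip hc k.2]
      · rw [h, blockFlip_blockFlip hc j.2]
    simp only [meanderMatrix, Matrix.of_apply, h1, h2, add_mul, ite_mul, one_mul, zero_mul,
      nsmul_eq_mul, ← ite_and, and_comm]
  rw [Finset.sum_congr rfl fun k _ => e k, Finset.sum_add_distrib, sum_ite_val_eq _ sa.1,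
    sum_ite_val_eq _ sc.1]
  rfl

lemma mul_meanderMatrix_apply (ha : a ≤ n) (hc : c ≤ n) (x : Matrix (Fin n) (Fin n) K)
    (i j : Fin n) : (x * meanderMatrix K n a c) j i =
    (if blockFlip n a i < i then entryNat x j (blockFlip n a i) else 0) +
      (if i < blockFlip n c i then (blockFlip n c i - i) • entryNat x j (blockFlip n c i)
        else 0) := by
  have sa := blockFlip_spec ha i.2
  have sc := blockFlip_spec hc i.2
  rw [Matrix.mul_apply, entryNat_of_lt x j.2 sa.1, entryNat_of_lt x j.2 sc.1]
  have e : ∀ k : Fin n, x j k * meanderMatrix K n a c k i =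
      (if (k : ℕ) = blockFlip n a i then (if k < i then x j k else 0) else 0) +
      (if (k : ℕ) = blockFlip n c i then (if i < k then ((k : ℕ) - i : ℕ) • x j k else 0)
        else 0) := by
    intro k
    simp only [meanderMatrix, Matrix.of_apply, mul_add, mul_ite, mul_one, mul_zero,
      nsmul_eq_mul, ← ite_and, and_comm, mul_comm]
  rw [Finset.sum_congr rfl fun k _ => e k, Finset.sum_add_distrib, sum_ite_val_eq _ sa.1,
    sum_ite_val_eq _ sc.1]
  rfl

lemma isMeanderKernel_of_mem_stab (ha : a ≤ n) (hc : c ≤ n) {x : Matrix (Fin n) (Fin n) K}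
    (hx : x ∈ stab a c (meanderMatrix K n a c)) : IsMeanderKernel n a c (entryNat x) where
  supp i j hij := by
    by_cases h : i < n ∧ j < n
    · refine ⟨h.1, h.2, ?_⟩
      rw [entryNat_of_lt x h.1 h.2] at hij
      by_contra hcon
      exact hij (hx.1 ⟨i, h.1⟩ ⟨j, h.2⟩ hcon)
    · exact absurd (dif_neg h) hij
  eqn i j hi hj hal := by
    have := commutator_apply_of_mem_stab hx (i := ⟨i, hi⟩) (j := ⟨j, hj⟩) hal
    rwa [meanderMatrix_mul_apply ha hc, mul_meanderMatrix_apply ha hc] at this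

/-- The number `gcd(n, c - a)` of orbits of the rotation by `c - a` on `ℤ/n`. -/
def rotGcd (n a c : ℕ) : ℕ := Int.gcd n ((c : ℤ) - a)

/-- The orbit of the residue `r` modulo `gcd(n, c - a)` under the reflection `r ↦ a - 1 - r`. -/
def residueOrbit (n a c : ℕ) (r : ZMod (rotGcd n a c)) : Sym2 (ZMod (rotGcd n a c)) :=
  s(r, a - 1 - r)

/-- The component of the meander containing the vertex `i`, labelled by an orbit of the reflection
`r ↦ a - 1 - r` on the residues modulo `gcd(n, c - a)`. -/
def component (n a c i : ℕ) : Sym2 (ZMod (rotGcd n a c)) := residueOrbit n a c i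

lemma cast_self_rotGcd (n a c : ℕ) : (n : ZMod (rotGcd n a c)) = 0 := by
  rw [ZMod.natCast_eq_zero_iff, ← Int.natCast_dvd_natCast]
  exact Int.gcd_dvd_left _ _

lemma cast_bottom_rotGcd (n a c : ℕ) : (c : ZMod (rotGcd n a c)) = a := by
  have h : (rotGcd n a c : ℤ) ∣ (c : ℤ) - a := Int.gcd_dvd_right _ _
  rw [← ZMod.intCast_zmod_eq_zero_iff_dvd] at h
  push_cast at h
  exact sub_eq_zero.1 h

lemma cast_blockFlip_top (ha : a ≤ n) {i : ℕ} (hi : i < n) :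
    ((blockFlip n a i : ℕ) : ZMod (rotGcd n a c)) = a - 1 - i := by
  have h0 := cast_self_rotGcd n a c
  rcases (blockFlip_spec ha hi).2 with ⟨-, h⟩ | ⟨-, -, h⟩
  · have := congrArg (Nat.cast (R := ZMod (rotGcd n a c))) h
    push_cast at this
    rw [← this]
    ring
  · have := congrArg (Nat.cast (R := ZMod (rotGcd n a c))) h
    push_cast at this
    rw [h0, zero_add] at this
    rw [← this]
    ring

lemma cast_blockFlip_bottom (hc : c ≤ n) {i : ℕ} (hi : i < n) :
    ((blockFlip n c i : ℕ) : ZMod (rotGcd n a c)) = a - 1 - i := by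
  have h0 := cast_self_rotGcd n a c
  rw [← cast_bottom_rotGcd n a c]
  rcases (blockFlip_spec hc hi).2 with ⟨-, h⟩ | ⟨-, -, h⟩
  · have := congrArg (Nat.cast (R := ZMod (rotGcd n a c))) h
    push_cast at this
    rw [← this]
    ring
  · have := congrArg (Nat.cast (R := ZMod (rotGcd n a c))) h
    push_cast at this
    rw [h0, zero_add] at this
    rw [← this]
    ring

lemma component_flip_top (ha : a ≤ n) {i : ℕ} (hi : i < n) :
    component n a c (blockFlip n a i) = component n a c i := by
  unfold component residueOrbit
  rw [cast_blockFlip_top ha hi, sub_sub_cancel, Sym2.eq_swap]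

lemma component_flip_bottom (hc : c ≤ n) {i : ℕ} (hi : i < n) :
    component n a c (blockFlip n c i) = component n a c i := by
  unfold component residueOrbit
  rw [cast_blockFlip_bottom hc hi, sub_sub_cancel, Sym2.eq_swap]

/-- The kernel of the meander form is block diagonal with respect to the components of the
meander. -/
lemma apply_eq_zero_of_component_ne [CharZero K] (ha : a ≤ n) (hc : c ≤ n)
    {x : Matrix (Fin n) (Fin n) K} (hx : x ∈ stab a c (meanderMatrix K n a c)) {i j : Fin n}
    (hij : component n a c i ≠ component n a c j) : x i j = 0 := by
  have h := isMeanderKernel_of_mem_stab ha hc hx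
  rw [← entryNat_val x i j]
  refine h.eq_zero_of_antidiag ha hc (fun i j => component n a c i ≠ component n a c j)
    ?_ ?_ ?_ ?_ hij (by rintro h0; exact hij (by rw [h0]))
  · intro i j hi hj hne
    rwa [component_flip_top ha hi, component_flip_top ha hj]
  · intro i j hi hj hne
    rwa [component_flip_bottom hc hi, component_flip_bottom hc hj]
  · intro i hi _ hne
    exact absurd (component_flip_top ha hi).symm hne
  · intro i hi _ hne
    exact absurd (component_flip_bottom hc hi).symm hne

/-- The kernel of the meander form embeds into the functions on the residues modulo
`gcd(n, c - a)`: the diagonal is even and the flow along the arcs is odd under the reflections, so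
both are recovered from their sum. -/
lemma finrank_stab_meanderMatrix_le [CharZero K] (hn : 0 < n) (ha : a ≤ n) (hc : c ≤ n) :
    Module.finrank K (stab a c (meanderMatrix K n a c)) ≤ rotGcd n a c := by
  have hg : 0 < rotGcd n a c := Int.gcd_pos_of_ne_zero_left _ (by omega)
  have hgn : rotGcd n a c ≤ n := by
    have : (rotGcd n a c : ℤ) ∣ n := Int.gcd_dvd_left _ _
    exact Nat.le_of_dvd hn (by exact_mod_cast this)
  let w : Matrix (Fin n) (Fin n) K → ℕ → K := fun x i => entryNat x i i + topFlow n a (entryNat x) i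
  let Φ : stab a c (meanderMatrix K n a c) →ₗ[K] (Fin (rotGcd n a c) → K) :=
    { toFun := fun x r => w x.1 r
      map_add' := by
        intro x y
        ext r
        simp only [w, topFlow, Submodule.coe_add, entryNat_add, Pi.add_apply]
        split_ifs <;> ring
      map_smul' := by
        intro t x
        ext r
        simp only [w, topFlow, Submodule.coe_smul, entryNat_smul, Pi.smul_apply, smul_eq_mul,
          RingHom.id_apply]
        split_ifs <;> ring }
  have hinj : Function.Injective Φ := by
    rw [injective_iff_map_eq_zero]
    rintro ⟨x, hx⟩ hΦ
    have h := isMeanderKernel_of_mem_stab ha hc hx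
    have hrot : ∀ i < n, w x (blockFlip n c (blockFlip n a i)) = w x i := by
      intro i hi
      have s1 := (blockFlip_spec ha hi).1
      have s2 := (blockFlip_spec hc s1).1
      simp only [w]
      have e1 := h.topFlow_add_bottomFlow s1
      have e2 := h.topFlow_add_bottomFlow s2
      rw [topFlow_flip ha _ hi] at e1
      rw [bottomFlow_flip hc _ s1] at e2
      rw [h.diag_bottom ha hc s1, h.diag_top ha hc hi]
      linear_combination e1 + e2
    have hw : ∀ i < n, w x i = 0 := by
      intro i hi
      have hlt := Nat.mod_lt i hg
      rw [eq_of_rotation_invariant ha hc hrot hi (hlt.trans_le hgn)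
        (by push_cast; exact (Int.mod_modEq _ _).symm)]
      exact congrFun hΦ ⟨i % rotGcd n a c, hlt⟩
    have hd : ∀ i < n, entryNat x i i = 0 ∧ topFlow n a (entryNat x) i = 0 := by
      intro i hi
      have h1 := hw i hi
      have h2 := hw _ (blockFlip_spec ha hi).1
      simp only [w] at h1 h2
      rw [h.diag_top ha hc hi, topFlow_flip ha _ hi] at h2
      have h3 : (2 : K) * entryNat x i i = 0 := by linear_combination h1 + h2
      have h4 : entryNat x i i = 0 := by simpa using h3
      exact ⟨h4, by rwa [h4, zero_add] at h1⟩
    ext i j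
    change x i j = 0
    rw [← entryNat_val x i j]
    by_cases hij : i = j
    · subst hij
      exact (hd i i.2).1
    refine h.eq_zero_of_antidiag ha hc (fun _ _ => True) (fun _ _ _ _ _ => trivial)
      (fun _ _ _ _ _ => trivial) ?_ ?_ trivial (fun h0 => hij (Fin.ext h0))
    · intro k hk hlt _
      have := (hd k hk).2
      unfold topFlow at this
      rw [if_neg (by omega), if_pos hlt] at this
      simpa using this
    · intro k hk hlt _
      have e := h.topFlow_add_bottomFlow hk
      rw [(hd k hk).2, zero_add] at e
      unfold bottomFlow at e
      rw [if_neg (by omega), if_pos hlt, zero_sub, neg_eq_zero, nsmul_eq_mul] at e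
      exact (mul_eq_zero.1 e).resolve_left (Nat.cast_ne_zero.2 (by omega))
  simpa using LinearMap.finrank_le_finrank_of_injective hinj

end

/-! ### Block diagonal functionals -/

lemma even_card_of_fixedPointFree_involution {α : Type*} [DecidableEq α] (s : Finset α)
    (f : α → α) (hf : ∀ x ∈ s, f x ∈ s) (hff : ∀ x ∈ s, f (f x) = x) (hne : ∀ x ∈ s, f x ≠ x) :
    Even s.card := by
  rw [← ZMod.natCast_eq_zero_iff_even, Finset.card_eq_sum_ones, Nat.cast_sum]
  exact Finset.sum_involution (fun x _ => f x) (fun _ _ => by decide)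
    (fun x hx _ => hne x hx) hf hff

/-- For an order-reversing involution without fixed points, the number of pairs `j < i` in a common
block has the parity of half the number of points: the involution acts on these pairs, and fixes
those of the form `(i, σ i)`. -/
lemma even_card_pairs_add_half {α : Type*} [LinearOrder α] (Z : Finset α) (σ : α → α)
    (T : α → α → Prop) [DecidableRel T] (hZ : ∀ i ∈ Z, σ i ∈ Z) (hσ : ∀ i ∈ Z, σ (σ i) = i)
    (hne : ∀ i ∈ Z, σ i ≠ i) (hT : ∀ i ∈ Z, T i (σ i))
    (hrev : ∀ i ∈ Z, ∀ j ∈ Z, j < i → T i j → σ i < σ j ∧ T (σ j) (σ i)) :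
    ∃ m, 2 * m = Z.card ∧
      Even (((Z ×ˢ Z).filter fun p => p.2 < p.1 ∧ T p.1 p.2).card + m) := by
  classical
  refine ⟨(Z.filter fun i => σ i < i).card, ?_, ?_⟩
  · have h1 : (Z.filter fun i => σ i < i).card = (Z.filter fun i => ¬ σ i < i).card := by
      refine Finset.card_bij' (fun i _ => σ i) (fun i _ => σ i) ?_ ?_ ?_ ?_
      · intro i hi
        rw [Finset.mem_filter] at hi ⊢
        refine ⟨hZ i hi.1, ?_⟩
        rw [hσ i hi.1]
        exact hi.2.not_gt
      · intro i hi
        rw [Finset.mem_filter] at hi ⊢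
        refine ⟨hZ i hi.1, ?_⟩
        rw [hσ i hi.1]
        exact lt_of_le_of_ne (not_lt.1 hi.2) (hne i hi.1).symm
      · intro i hi
        exact hσ i (Finset.mem_filter.1 hi).1
      · intro i hi
        exact hσ i (Finset.mem_filter.1 hi).1
    have h2 := Finset.card_filter_add_card_filter_not (s := Z) (fun i => σ i < i)
    omega
  · set S := (Z ×ˢ Z).filter fun p => p.2 < p.1 ∧ T p.1 p.2 with hS
    have h1 : (S.filter fun p => p.2 = σ p.1).card = (Z.filter fun i => σ i < i).card := by
      refine Finset.card_bij' (fun p _ => p.1) (fun i _ => (i, σ i)) ?_ ?_ ?_ ?_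
      · rintro ⟨i, j⟩ hp
        simp only [hS, Finset.mem_filter, Finset.mem_product] at hp ⊢
        obtain ⟨⟨⟨hi, hj⟩, hlt, -⟩, rfl⟩ := hp
        exact ⟨hi, hlt⟩
      · intro i hi
        simp only [hS, Finset.mem_filter, Finset.mem_product] at hi ⊢
        exact ⟨⟨⟨hi.1, hZ i hi.1⟩, hi.2, hT i hi.1⟩, trivial⟩
      · rintro ⟨i, j⟩ hp
        simp only [Finset.mem_filter] at hp
        rw [hp.2]
      · intro i _
        rfl
    have h2 : Even (S.filter fun p => ¬ p.2 = σ p.1).card := by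
      refine even_card_of_fixedPointFree_involution _ (fun p => (σ p.2, σ p.1)) ?_ ?_ ?_
      · rintro ⟨i, j⟩ hp
        simp only [hS, Finset.mem_filter, Finset.mem_product] at hp ⊢
        obtain ⟨⟨⟨hi, hj⟩, hlt, hTij⟩, hn⟩ := hp
        refine ⟨⟨⟨hZ j hj, hZ i hi⟩, hrev i hi j hj hlt hTij⟩, ?_⟩
        rw [hσ j hj]
        exact fun h => hn h.symm
      · rintro ⟨i, j⟩ hp
        simp only [hS, Finset.mem_filter, Finset.mem_product] at hp
        simp only [hσ i hp.1.1.1, hσ j hp.1.1.2]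
      · rintro ⟨i, j⟩ hp heq
        simp only [hS, Finset.mem_filter, Finset.mem_product, Prod.mk.injEq] at hp heq
        exact hp.2 heq.2.symm
    have h3 := Finset.card_filter_add_card_filter_not (s := S) (fun p => p.2 = σ p.1)
    rw [h1] at h3
    obtain ⟨k, hk⟩ := h2
    exact ⟨k + (Z.filter fun i => σ i < i).card, by omega⟩

lemma one_le_finrank_of_mem {K U : Type*} [Field K] [AddCommGroup U] [Module K U]
    [FiniteDimensional K U] {W : Submodule K U} {u : U} (hu : u ∈ W) (hu0 : u ≠ 0) :
    1 ≤ Module.finrank K W :=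
  Module.finrank_pos_iff_exists_ne_zero.2 ⟨⟨u, hu⟩, fun h => hu0 (congrArg Subtype.val h)⟩

lemma finrank_pi_submodule {K ι : Type*} {U : ι → Type*} [Field K] [Fintype ι]
    [∀ i, AddCommGroup (U i)] [∀ i, Module K (U i)] [∀ i, FiniteDimensional K (U i)]
    (W : ∀ i, Submodule K (U i)) :
    Module.finrank K (∀ i, W i) = ∑ i, Module.finrank K (W i) :=
  Module.finrank_pi_fintype K

/-- A skew-symmetric form on a space of even dimension has a kernel of dimension at least two as
soon as the kernel is nonzero: the form has even rank. -/
lemma two_le_finrank_ker_of_skew {K U : Type*} [Field K] [CharZero K] [AddCommGroup U] [Module K U]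
    [FiniteDimensional K U] (B : U →ₗ[K] U →ₗ[K] K) (hB : ∀ x y, B x y = - B y x)
    (heven : Even (Module.finrank K U)) {u : U} (hu : u ≠ 0) (hu' : B u = 0) :
    2 ≤ Module.finrank K (LinearMap.ker B) := by
  by_contra hlt
  have h1 : Module.finrank K (LinearMap.ker B) = 1 := by
    have : 0 < Module.finrank K (LinearMap.ker B) := by
      rw [Module.finrank_pos_iff_exists_ne_zero]
      exact ⟨⟨u, hu'⟩, fun h => hu (congrArg Subtype.val h)⟩
    omega
  obtain ⟨W, hW⟩ := Submodule.exists_isCompl (LinearMap.ker B)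
  have hodd : Odd (Module.finrank K W) := by
    have := Submodule.finrank_add_eq_of_isCompl hW
    rw [h1] at this
    rw [← this] at heven
    rw [← Nat.not_even_iff_odd]
    intro hW'
    exact absurd ((Nat.even_add.1 heven).2 hW') (by decide)
  let b := Module.finBasis K W
  let M : Matrix (Fin (Module.finrank K W)) (Fin (Module.finrank K W)) K :=
    Matrix.of fun i j => B (b i) (b j)
  have hM : M.transpose = -M := by
    ext i j
    exact hB _ _
  have hdet : M.det = 0 := by
    have h := congrArg Matrix.det hM
    rw [Matrix.det_transpose, Matrix.det_neg, Fintype.card_fin, hodd.neg_one_pow, neg_one_mul] at h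
    have h2 : (2 : K) * M.det = 0 := by linear_combination h
    simpa using h2
  obtain ⟨v, hv, hMv⟩ := Matrix.exists_mulVec_eq_zero_iff.2 hdet
  set w : W := ∑ i, v i • b i with hw
  have hw0 : w ≠ 0 := by
    intro h0
    apply hv
    ext i
    exact (Fintype.linearIndependent_iff.1 b.linearIndependent) v h0 i
  have hBw : ∀ y : W, B y w = 0 := by
    intro y
    have hb : ∀ i, B (b i) w = 0 := by
      intro i
      have := congrFun hMv i
      simp only [Matrix.mulVec, dotProduct, M, Matrix.of_apply, Pi.zero_apply] at this
      simp only [hw, AddSubmonoidClass.coe_finsetSum, Submodule.coe_smul, map_sum, map_smul,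
        smul_eq_mul]
      rw [← this]
      exact Finset.sum_congr rfl fun j _ => mul_comm _ _
    rw [← b.sum_repr y]
    simp only [AddSubmonoidClass.coe_finsetSum, Submodule.coe_smul, map_sum, map_smul,
      LinearMap.sum_apply, LinearMap.smul_apply, hb, smul_zero, Finset.sum_const_zero]
  apply hw0
  have hker : (w : U) ∈ LinearMap.ker B := by
    rw [LinearMap.mem_ker]
    ext x
    obtain ⟨p, hp, q, hq, rfl⟩ : ∃ p ∈ LinearMap.ker B, ∃ q ∈ W, p + q = x :=
      Submodule.mem_sup.1 (hW.sup_eq_top ▸ Submodule.mem_top)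
    rw [map_add, hB _ p, LinearMap.mem_ker.1 hp, hB _ q, hBw ⟨q, hq⟩]
    simp
  have := (Submodule.disjoint_def.1 hW.disjoint) w hker w.2
  exact Subtype.ext this

section

variable {K : Type*} [Field K] {n a c : ℕ}

/-- The matrices of `seaweedAlg K n a c` supported on the component `z` of the meander. -/
def componentSpace (K : Type*) [Field K] (n a c : ℕ) (z : Sym2 (ZMod (rotGcd n a c))) :
    Submodule K (Matrix (Fin n) (Fin n) K) where
  carrier := {x | ∀ i j : Fin n,
    ¬ (Allowed a c i j ∧ component n a c i = z ∧ component n a c j = z) → x i j = 0}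
  add_mem' := by
    intro x y hx hy i j hij
    rw [Matrix.add_apply, hx i j hij, hy i j hij, add_zero]
  zero_mem' := fun _ _ _ => rfl
  smul_mem' := by
    intro r x hx i j hij
    rw [Matrix.smul_apply, hx i j hij, smul_zero]

lemma componentSpace_le (z : Sym2 (ZMod (rotGcd n a c))) {x : Matrix (Fin n) (Fin n) K}
    (hx : x ∈ componentSpace K n a c z) : x ∈ seaweedAlg K n a c :=
  fun i j hij => hx i j fun h => hij h.1

/-- The Kirillov form of `x ↦ tr (F x)` on the matrices supported on one component. -/
def componentForm (F : Matrix (Fin n) (Fin n) K) (z : Sym2 (ZMod (rotGcd n a c))) :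
    componentSpace K n a c z →ₗ[K] componentSpace K n a c z →ₗ[K] K :=
  LinearMap.mk₂ K (fun x y => (F * (x.1 * y.1 - y.1 * x.1)).trace)
    (fun x x' y => by
      rw [← Matrix.trace_add]; congr 1; simp only [Submodule.coe_add]; noncomm_ring)
    (fun r x y => by
      rw [← Matrix.trace_smul]; congr 1
      simp only [Submodule.coe_smul, smul_mul_assoc, mul_smul_comm, ← smul_sub])
    (fun x y y' => by
      rw [← Matrix.trace_add]; congr 1; simp only [Submodule.coe_add]; noncomm_ring)
    (fun r x y => by
      rw [← Matrix.trace_smul]; congr 1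
      simp only [Submodule.coe_smul, smul_mul_assoc, mul_smul_comm, ← smul_sub])

lemma componentForm_apply (F : Matrix (Fin n) (Fin n) K) (z : Sym2 (ZMod (rotGcd n a c)))
    (x y : componentSpace K n a c z) :
    componentForm F z x y = (F * (x.1 * y.1 - y.1 * x.1)).trace := rfl

open Classical in
lemma finrank_componentSpace (z : Sym2 (ZMod (rotGcd n a c))) :
    Module.finrank K (componentSpace K n a c z) =
      ((Finset.univ : Finset (Fin n × Fin n)).filter fun p =>
        Allowed a c p.1 p.2 ∧ component n a c p.1 = z ∧ component n a c p.2 = z).card := by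
  let S := {p : Fin n × Fin n //
    Allowed a c p.1 p.2 ∧ component n a c p.1 = z ∧ component n a c p.2 = z}
  let e : componentSpace K n a c z ≃ₗ[K] (S → K) :=
    { toFun := fun x p => x.1 p.1.1 p.1.2
      map_add' := fun _ _ => rfl
      map_smul' := fun _ _ => rfl
      invFun := fun f => ⟨Matrix.of fun i j => if h : _ then f ⟨(i, j), h⟩ else 0,
        fun i j hij => by rw [Matrix.of_apply, dif_neg hij]⟩
      left_inv := by
        rintro ⟨x, hx⟩
        ext i j
        change (if h : _ then x i j else 0) = x i j
        split_ifs with h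
        · rfl
        · exact (hx i j h).symm
      right_inv := by
        intro f
        ext ⟨⟨i, j⟩, h⟩
        exact dif_pos h }
  rw [e.finrank_eq, Module.finrank_fintype_fun_eq_card, Fintype.card_subtype]

lemma even_finrank_componentSpace (ha : a ≤ n) (hc : c ≤ n) (z : Sym2 (ZMod (rotGcd n a c)))
    (hz : ∀ r, z = residueOrbit n a c r → r ≠ a - 1 - r) :
    Even (Module.finrank K (componentSpace K n a c z)) := by
  classical
  rw [finrank_componentSpace]
  let Z : Finset (Fin n) := Finset.univ.filter fun i => component n a c i = z
  have hmem : ∀ i, i ∈ Z ↔ component n a c i = z := fun i => by simp [Z]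
  have fixfree : ∀ i : Fin n, component n a c i = z →
      ((i : ℕ) : ZMod (rotGcd n a c)) ≠ a - 1 - (i : ℕ) := fun i hi => hz _ hi.symm
  let σ : Fin n → Fin n := fun i => ⟨blockFlip n a i, (blockFlip_spec ha i.2).1⟩
  let τ : Fin n → Fin n := fun i => ⟨blockFlip n c i, (blockFlip_spec hc i.2).1⟩
  obtain ⟨m, hm, h1⟩ := even_card_pairs_add_half Z σ (fun i j => ((i : ℕ) < a ↔ (j : ℕ) < a))
    (fun i hi => by rw [hmem] at hi ⊢; rw [← hi]; exact component_flip_top ha i.2)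
    (fun i _ => Fin.ext (blockFlip_blockFlip ha i.2))
    (fun i hi h => by
      rw [hmem] at hi
      have h' : ((blockFlip n a i : ℕ) : ZMod (rotGcd n a c)) = (i : ℕ) := by
        rw [show blockFlip n a i = i from congrArg Fin.val h]
      rw [cast_blockFlip_top ha i.2] at h'
      exact fixfree i hi h'.symm)
    (fun i _ => by
      have := blockFlip_spec ha i.2
      change _ ↔ blockFlip n a i < a
      omega)
    (fun i _ j _ hij hT => by
      have := blockFlip_spec ha i.2
      have := blockFlip_spec ha j.2
      change blockFlip n a i < blockFlip n a j ∧ (blockFlip n a j < a ↔ blockFlip n a i < a)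
      omega)
  obtain ⟨m', hm', h2⟩ := even_card_pairs_add_half Z τ (fun i j => ((i : ℕ) < c ↔ (j : ℕ) < c))
    (fun i hi => by rw [hmem] at hi ⊢; rw [← hi]; exact component_flip_bottom hc i.2)
    (fun i _ => Fin.ext (blockFlip_blockFlip hc i.2))
    (fun i hi h => by
      rw [hmem] at hi
      have h' : ((blockFlip n c i : ℕ) : ZMod (rotGcd n a c)) = (i : ℕ) := by
        rw [show blockFlip n c i = i from congrArg Fin.val h]
      rw [cast_blockFlip_bottom hc i.2] at h'
      exact fixfree i hi h'.symm)
    (fun i _ => by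
      have := blockFlip_spec hc i.2
      change _ ↔ blockFlip n c i < c
      omega)
    (fun i _ j _ hij hT => by
      have := blockFlip_spec hc i.2
      have := blockFlip_spec hc j.2
      change blockFlip n c i < blockFlip n c j ∧ (blockFlip n c j < c ↔ blockFlip n c i < c)
      omega)
  -- The positions of the component: lower ones, upper ones (here transposed), and diagonal ones.
  set S := (Finset.univ : Finset (Fin n × Fin n)).filter fun p =>
    Allowed a c p.1 p.2 ∧ component n a c p.1 = z ∧ component n a c p.2 = z with hS
  have hSmem : ∀ i j, (i, j) ∈ S ↔
      Allowed a c i j ∧ component n a c i = z ∧ component n a c j = z := fun i j => by simp [hS]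
  have e1 : S.filter (fun p => p.2 < p.1) =
      (Z ×ˢ Z).filter fun p => p.2 < p.1 ∧ ((p.1 : ℕ) < a ↔ (p.2 : ℕ) < a) := by
    ext ⟨i, j⟩
    simp only [Finset.mem_filter, hSmem, Finset.mem_product, hmem, Allowed, Fin.lt_def]
    constructor
    · rintro ⟨⟨h, hi, hj⟩, hlt⟩
      exact ⟨⟨hi, hj⟩, hlt, by omega⟩
    · rintro ⟨⟨hi, hj⟩, hlt, h⟩
      exact ⟨⟨by omega, hi, hj⟩, hlt⟩
  have e2 : ((S.filter (fun p => ¬ p.2 < p.1)).filter fun p => p.1 < p.2).card =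
      ((Z ×ˢ Z).filter fun p => p.2 < p.1 ∧ ((p.1 : ℕ) < c ↔ (p.2 : ℕ) < c)).card := by
    refine Finset.card_bij' (fun p _ => p.swap) (fun p _ => p.swap) ?_ ?_ (fun p _ => p.swap_swap)
      (fun p _ => p.swap_swap)
    · rintro ⟨i, j⟩ h
      simp only [Finset.mem_filter, hSmem, Finset.mem_product, hmem, Allowed, Fin.lt_def,
        Prod.swap_prod_mk] at h ⊢
      obtain ⟨⟨⟨h, hi, hj⟩, -⟩, hlt⟩ := h
      exact ⟨⟨hj, hi⟩, hlt, by omega⟩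
    · rintro ⟨i, j⟩ h
      simp only [Finset.mem_filter, hSmem, Finset.mem_product, hmem, Allowed, Fin.lt_def,
        Prod.swap_prod_mk] at h ⊢
      obtain ⟨⟨hi, hj⟩, hlt, h⟩ := h
      exact ⟨⟨⟨by omega, hj, hi⟩, by omega⟩, hlt⟩
  have e3 : ((S.filter (fun p => ¬ p.2 < p.1)).filter fun p => ¬ p.1 < p.2).card = Z.card := by
    refine Finset.card_bij' (fun p _ => p.1) (fun i _ => (i, i)) ?_ ?_ ?_ (fun _ _ => rfl)
    · rintro ⟨i, j⟩ h
      simp only [Finset.mem_filter, hSmem, hmem] at h ⊢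
      exact h.1.1.2.1
    · intro i h
      rw [hmem] at h
      simp only [Finset.mem_filter, hSmem, h, Allowed, lt_irrefl, not_false_eq_true, and_true]
      omega
    · rintro ⟨i, j⟩ h
      simp only [Finset.mem_filter, not_lt] at h
      rw [le_antisymm h.2 h.1.2]
  have s1 := Finset.card_filter_add_card_filter_not (s := S) (fun p => p.2 < p.1)
  have s2 := Finset.card_filter_add_card_filter_not (s := S.filter (fun p => ¬ p.2 < p.1))
    (fun p => p.1 < p.2)
  rw [e1] at s1
  rw [e2, e3] at s2
  obtain ⟨k, hk⟩ := h1
  obtain ⟨l, hl⟩ := h2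
  exact ⟨k + l, by omega⟩

/-- On block diagonal functionals, the kernel of a component form lies in the kernel of the whole
form. -/
lemma mem_stab_of_mem_ker_componentForm {F : Matrix (Fin n) (Fin n) K}
    (hF : ∀ i j : Fin n, Allowed a c j i → component n a c i ≠ component n a c j → F i j = 0)
    {z : Sym2 (ZMod (rotGcd n a c))} {x : componentSpace K n a c z}
    (hx : x ∈ LinearMap.ker (componentForm F z)) : x.1 ∈ stab a c F := by
  classical
  refine ⟨componentSpace_le z x.2, fun y hy => ?_⟩
  let y' : Matrix (Fin n) (Fin n) K := Matrix.of fun i j =>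
    if component n a c i = z ∧ component n a c j = z then y i j else 0
  have y'_pos : ∀ {i j : Fin n}, component n a c i = z ∧ component n a c j = z → y' i j = y i j :=
    fun h => if_pos h
  have y'_neg : ∀ {i j : Fin n}, ¬ (component n a c i = z ∧ component n a c j = z) → y' i j = 0 :=
    fun h => if_neg h
  have hy' : y' ∈ componentSpace K n a c z := by
    intro i j hij
    by_cases h : component n a c i = z ∧ component n a c j = z
    · rw [y'_pos h]
      exact hy i j fun h' => hij ⟨h', h⟩
    · exact y'_neg h
  have h0 : (F * (x.1 * y' - y' * x.1)).trace = 0 := by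
    have := congrArg (fun f => f ⟨y', hy'⟩) (LinearMap.mem_ker.1 hx)
    exact this
  have h1 : (F * (x.1 * (y - y'))).trace = 0 := by
    rw [Matrix.trace]
    refine Finset.sum_eq_zero fun j _ => ?_
    rw [Matrix.diag_apply, Matrix.mul_apply]
    refine Finset.sum_eq_zero fun i _ => ?_
    rw [Matrix.mul_apply]
    by_cases hj : component n a c j = z
    · rw [Finset.sum_eq_zero, mul_zero]
      intro k _
      by_cases hk : component n a c k = z
      · rw [Matrix.sub_apply, y'_pos ⟨hk, hj⟩, sub_self, mul_zero]
      · rw [x.2 i k fun h => hk h.2.2, zero_mul]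
    · by_cases hi : Allowed a c i j ∧ component n a c i = z
      · rw [hF j i hi.1 (by rw [hi.2]; exact hj), zero_mul]
      · rw [Finset.sum_eq_zero, mul_zero]
        intro k _
        by_cases hik : Allowed a c i k ∧ component n a c i = z ∧ component n a c k = z
        · have hkj : ¬ Allowed a c k j := by
            intro hkj
            apply hi
            refine ⟨?_, hik.2.1⟩
            have := hik.1
            unfold Allowed at *
            omega
          rw [Matrix.sub_apply, y'_neg (fun h => hj h.2), hy k j hkj, sub_zero,
            mul_zero]
        · rw [x.2 i k hik, zero_mul]
  have h2 : (F * ((y - y') * x.1)).trace = 0 := by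
    rw [Matrix.trace]
    refine Finset.sum_eq_zero fun j _ => ?_
    rw [Matrix.diag_apply, Matrix.mul_apply]
    refine Finset.sum_eq_zero fun i _ => ?_
    rw [Matrix.mul_apply]
    by_cases hi : component n a c i = z
    · rw [Finset.sum_eq_zero, mul_zero]
      intro k _
      by_cases hk : component n a c k = z
      · rw [Matrix.sub_apply, y'_pos ⟨hi, hk⟩, sub_self, zero_mul]
      · rw [x.2 k j fun h => hk h.2.1, mul_zero]
    · by_cases hj : Allowed a c i j ∧ component n a c j = z
      · rw [hF j i hj.1 (by rw [hj.2]; exact fun h => hi h.symm), zero_mul]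
      · rw [Finset.sum_eq_zero, mul_zero]
        intro k _
        by_cases hkj : Allowed a c k j ∧ component n a c k = z ∧ component n a c j = z
        · have hik : ¬ Allowed a c i k := by
            intro hik
            apply hj
            refine ⟨?_, hkj.2.2⟩
            have := hkj.1
            unfold Allowed at *
            omega
          rw [Matrix.sub_apply, y'_neg (fun h => hi h.1), hy i k hik, sub_zero,
            zero_mul]
        · rw [x.2 k j hkj, mul_zero]
  rw [show F * (x.1 * y - y * x.1) = F * (x.1 * y' - y' * x.1) + F * (x.1 * (y - y')) -
    F * ((y - y') * x.1) by noncomm_ring, Matrix.trace_sub, Matrix.trace_add, h0, h1, h2]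
  simp

/-- Each component contributes at least as many dimensions to the kernel as it has residues: the
identity matrix of the component lies in the kernel, and if the component consists of two residues,
then its matrices form a space of even dimension. -/
lemma card_residues_le_finrank_ker [CharZero K] [NeZero (rotGcd n a c)] (ha : a ≤ n) (hc : c ≤ n)
    (hgn : rotGcd n a c ≤ n)
    (F : Matrix (Fin n) (Fin n) K) (z : Sym2 (ZMod (rotGcd n a c))) :
    ((Finset.univ : Finset (ZMod (rotGcd n a c))).filter fun r => residueOrbit n a c r = z).card ≤
      Module.finrank K (LinearMap.ker (componentForm F z)) := by
  classical
  rcases Finset.eq_empty_or_nonempty ((Finset.univ : Finset (ZMod (rotGcd n a c))).filter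
    fun r => residueOrbit n a c r = z) with h0 | ⟨r, hr⟩
  · rw [h0]
    simp
  rw [Finset.mem_filter] at hr
  obtain ⟨-, rfl⟩ := hr
  set z := residueOrbit n a c r with hz
  let E : Matrix (Fin n) (Fin n) K := Matrix.diagonal fun i =>
    if component n a c i = z then 1 else 0
  have E_diag : ∀ i, E i i = if component n a c i = z then 1 else 0 :=
    fun i => Matrix.diagonal_apply_eq _ i
  have hE : E ∈ componentSpace K n a c z := by
    intro i j hij
    by_cases h : i = j
    · subst h
      rw [E_diag, if_neg]
      intro h
      exact hij ⟨by unfold Allowed; omega, h, h⟩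
    · exact Matrix.diagonal_apply_ne _ h
  have hE0 : (⟨E, hE⟩ : componentSpace K n a c z) ≠ 0 := by
    intro h
    have hlt : r.val < n := (ZMod.val_lt r).trans_le hgn
    have := congrFun (congrFun (congrArg Subtype.val h) ⟨r.val, hlt⟩) ⟨r.val, hlt⟩
    change E _ _ = 0 at this
    rw [E_diag, if_pos] at this
    · exact one_ne_zero this
    · unfold component
      rw [ZMod.natCast_zmod_val, hz]
  have hker : componentForm F z ⟨E, hE⟩ = 0 := by
    ext y
    rw [componentForm_apply]
    have e : E * y.1 = y.1 ∧ y.1 * E = y.1 := by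
      constructor
      · ext i j
        rw [Matrix.diagonal_mul]
        by_cases h : component n a c i = z
        · rw [if_pos h, one_mul]
        · rw [y.2 i j fun h' => h h'.2.1, mul_zero]
      · ext i j
        rw [Matrix.mul_diagonal]
        by_cases h : component n a c j = z
        · rw [if_pos h, mul_one]
        · rw [y.2 i j fun h' => h h'.2.2, zero_mul]
    simp only [e.1, e.2, sub_self, mul_zero, Matrix.trace_zero, LinearMap.zero_apply]
  have hsub : ((Finset.univ : Finset (ZMod (rotGcd n a c))).filter
      fun s => residueOrbit n a c s = z) ⊆ {r, a - 1 - r} := by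
    intro s hs
    rw [Finset.mem_filter, hz, residueOrbit, residueOrbit, Sym2.eq_iff] at hs
    rw [Finset.mem_insert, Finset.mem_singleton]
    rcases hs.2 with h | h
    · exact Or.inl h.1
    · exact Or.inr h.1
  by_cases hfix : r = a - 1 - r
  · rw [← hfix, Finset.pair_eq_singleton] at hsub
    refine (Finset.card_le_card hsub).trans ?_
    rw [Finset.card_singleton]
    exact one_le_finrank_of_mem (LinearMap.mem_ker.2 hker) hE0
  · refine (Finset.card_le_card hsub).trans (Finset.card_le_two.trans ?_)
    refine two_le_finrank_ker_of_skew _ ?_ ?_ hE0 hker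
    · intro x y
      rw [componentForm_apply, componentForm_apply, ← Matrix.trace_neg, ← mul_neg, neg_sub]
    · apply even_finrank_componentSpace ha hc
      intro s hs hs'
      rw [hz, residueOrbit, residueOrbit, Sym2.eq_iff] at hs
      apply hfix
      rcases hs with h | h
      · rw [h.1]; exact hs'
      · rw [h.1, sub_sub_cancel]; exact hs'.symm

/-- Block diagonal functionals have a kernel of dimension at least `gcd(n, c - a)`. -/
lemma rotGcd_le_finrank_stab_of_blockDiagonal [CharZero K] (hn : 0 < n) (ha : a ≤ n) (hc : c ≤ n)
    {F : Matrix (Fin n) (Fin n) K}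
    (hF : ∀ i j : Fin n, Allowed a c j i → component n a c i ≠ component n a c j → F i j = 0) :
    rotGcd n a c ≤ Module.finrank K (stab a c F) := by
  classical
  have hg : 0 < rotGcd n a c := Int.gcd_pos_of_ne_zero_left _ (by omega)
  have hgn : rotGcd n a c ≤ n := by
    have : (rotGcd n a c : ℤ) ∣ n := Int.gcd_dvd_left _ _
    exact Nat.le_of_dvd hn (by exact_mod_cast this)
  have : NeZero (rotGcd n a c) := ⟨hg.ne'⟩
  let Ψ : (∀ z : Sym2 (ZMod (rotGcd n a c)), LinearMap.ker (componentForm F z)) →ₗ[K]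
      stab a c F :=
    ∑ z, (LinearMap.codRestrict (stab a c F)
      ((componentSpace K n a c z).subtype ∘ₗ (LinearMap.ker (componentForm F z)).subtype)
      (fun x => mem_stab_of_mem_ker_componentForm hF x.2)) ∘ₗ LinearMap.proj z
  have hΨ : ∀ x i j, (Ψ x).1 i j = ∑ z, (x z).1.1 i j := by
    intro x i j
    simp only [Ψ, LinearMap.sum_apply, AddSubmonoidClass.coe_finsetSum, Matrix.sum_apply]
    rfl
  have hinj : Function.Injective Ψ := by
    rw [injective_iff_map_eq_zero]
    intro x hx
    funext z
    apply Subtype.ext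
    apply Subtype.ext
    ext i j
    change (x z).1.1 i j = 0
    by_cases hi : component n a c i = z
    · have h1 := hΨ x i j
      rw [hx, Finset.sum_eq_single z] at h1
      · exact h1.symm
      · intro z' _ hz'
        exact (x z').1.2 i j fun h => hz' (h.2.1.symm.trans hi)
      · simp
    · exact (x z).1.2 i j fun h => hi h.2.1
  calc rotGcd n a c = (Finset.univ : Finset (ZMod (rotGcd n a c))).card := by
        rw [Finset.card_univ, ZMod.card]
    _ = ∑ z : Sym2 (ZMod (rotGcd n a c)),
        ((Finset.univ : Finset (ZMod (rotGcd n a c))).filter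
          fun r => residueOrbit n a c r = z).card :=
        Finset.card_eq_sum_card_fiberwise fun _ _ => Finset.mem_coe.2 (Finset.mem_univ _)
    _ ≤ ∑ z, Module.finrank K (LinearMap.ker (componentForm F z)) :=
        Finset.sum_le_sum fun z _ => card_residues_le_finrank_ker ha hc hgn F z
    _ = Module.finrank K (∀ z, LinearMap.ker (componentForm F z)) :=
        (finrank_pi_submodule fun z : Sym2 (ZMod (rotGcd n a c)) =>
          LinearMap.ker (componentForm F z)).symm
    _ ≤ Module.finrank K (stab a c F) := LinearMap.finrank_le_finrank_of_injective hinj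

end

/-! ### Vanishing on curves and semicontinuity of the kernel -/

lemma MvPolynomial.IsHomogeneous.aeval_mul_left {σ K S : Type*} [CommSemiring K] [CommSemiring S]
    [Algebra K S] {φ : MvPolynomial σ K} {k : ℕ} (hφ : φ.IsHomogeneous k) (t : S) (q : σ → S) :
    MvPolynomial.aeval (fun i => t * q i) φ = t ^ k * MvPolynomial.aeval q φ := by
  rw [MvPolynomial.aeval_def, MvPolynomial.aeval_def, MvPolynomial.eval₂_eq, MvPolynomial.eval₂_eq,
    Finset.mul_sum]
  refine Finset.sum_congr rfl fun d hd => ?_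
  have hk : ∑ i ∈ d.support, d i = k := by
    have := hφ.degree_eq_sum_deg_support hd
    exact this.symm
  simp only [mul_pow]
  rw [Finset.prod_mul_distrib, Finset.prod_pow_eq_pow_sum, hk]
  ring

/-- A polynomial function vanishing on some curve through `F₀` with each given tangent vector is
zero: otherwise its lowest-order homogeneous part at `F₀` would vanish at every tangent vector. -/
lemma MvPolynomial.eq_zero_of_vanishes_on_curves {σ K : Type*} [Field K] [Infinite K]
    (Q : MvPolynomial σ K) (F₀ : σ → K)
    (h : ∀ v : σ → K, ∃ p : σ → Polynomial K,
      (∀ i, (p i).coeff 0 = F₀ i ∧ (p i).coeff 1 = v i) ∧ MvPolynomial.aeval p Q = 0) : Q = 0 := by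
  classical
  set Q' : MvPolynomial σ K :=
    MvPolynomial.aeval (fun i => MvPolynomial.X i + MvPolynomial.C (F₀ i)) Q with hQ'
  have hback : MvPolynomial.aeval (fun i => MvPolynomial.X i - MvPolynomial.C (F₀ i)) Q' = Q := by
    rw [hQ', ← AlgHom.comp_apply, MvPolynomial.comp_aeval]
    simp [MvPolynomial.algHom_C, MvPolynomial.algebraMap_eq]
  suffices hz : Q' = 0 by rw [← hback, hz, map_zero]
  by_contra hne
  have hex : ∃ m, MvPolynomial.homogeneousComponent m Q' ≠ 0 := by
    by_contra hcon
    push Not at hcon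
    apply hne
    rw [← MvPolynomial.sum_homogeneousComponent Q']
    exact Finset.sum_eq_zero fun i _ => hcon i
  set m := Nat.find hex with hm
  have hm0 := Nat.find_spec hex
  have hlow : ∀ k < m, MvPolynomial.homogeneousComponent k Q' = 0 := fun k hk => by
    simpa using Nat.find_min hex hk
  obtain ⟨v, hv⟩ : ∃ v, MvPolynomial.eval v (MvPolynomial.homogeneousComponent m Q') ≠ 0 := by
    by_contra hcon
    push Not at hcon
    exact hm0 (MvPolynomial.funext fun v => by rw [hcon v, map_zero])
  obtain ⟨p, hp, hpQ⟩ := h v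
  -- The curve is `F₀ + X * q` with `q` of constant term `v`.
  have hdvd : ∀ i, ∃ q : Polynomial K, p i - Polynomial.C (F₀ i) = Polynomial.X * q := fun i => by
    have : Polynomial.X ∣ p i - Polynomial.C (F₀ i) := by
      rw [Polynomial.X_dvd_iff, Polynomial.coeff_sub, (hp i).1, Polynomial.coeff_C_zero, sub_self]
    exact this
  choose q hq using hdvd
  have hq0 : ∀ i, (q i).coeff 0 = v i := fun i => by
    have := congrArg (fun r => Polynomial.coeff r 1) (hq i)
    simp only [Polynomial.coeff_sub, (hp i).2, Polynomial.coeff_C_succ, sub_zero,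
      Polynomial.coeff_X_mul] at this
    rw [this]
  have hQ'0 : MvPolynomial.aeval (fun i => Polynomial.X * q i) Q' = 0 := by
    rw [hQ', ← AlgHom.comp_apply, MvPolynomial.comp_aeval, ← hpQ]
    congr 2
    funext i
    rw [map_add, MvPolynomial.aeval_X, MvPolynomial.aeval_C, ← hq i]
    simp
  have hcoeff := congrArg (fun r => Polynomial.coeff r m) hQ'0
  simp only [Polynomial.coeff_zero] at hcoeff
  rw [← MvPolynomial.sum_homogeneousComponent Q', map_sum, Polynomial.finsetSum_coeff] at hcoeff
  have hterm : ∀ k, (MvPolynomial.aeval (fun i => Polynomial.X * q i)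
      (MvPolynomial.homogeneousComponent k Q')).coeff m =
      if k = m then MvPolynomial.eval v (MvPolynomial.homogeneousComponent m Q') else 0 := by
    intro k
    rcases lt_trichotomy k m with hk | hk | hk
    · rw [hlow k hk, map_zero, Polynomial.coeff_zero, if_neg hk.ne]
    · rw [(MvPolynomial.homogeneousComponent_isHomogeneous k Q').aeval_mul_left,
        Polynomial.coeff_X_pow_mul', if_pos hk.le, if_pos hk, hk, Nat.sub_self,
        Polynomial.coeff_zero_eq_eval_zero]
      have e : ∀ φ : MvPolynomial σ K,
          (MvPolynomial.aeval q φ).eval 0 = MvPolynomial.eval v φ := by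
        intro φ
        have hv' : (fun i => Polynomial.aeval (0 : K) (q i)) = v := by
          funext i
          rw [Polynomial.coe_aeval_eq_eval, ← Polynomial.coeff_zero_eq_eval_zero, hq0]
        rw [← Polynomial.coe_aeval_eq_eval, ← AlgHom.comp_apply, MvPolynomial.comp_aeval, hv']
        rfl
      exact e _
    · rw [(MvPolynomial.homogeneousComponent_isHomogeneous k Q').aeval_mul_left,
        Polynomial.coeff_X_pow_mul', if_neg hk.not_ge, if_neg hk.ne']
  simp only [hterm] at hcoeff
  rw [Finset.sum_ite_eq', if_pos] at hcoeff
  · exact hv hcoeff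
  · rw [Finset.mem_range, Nat.lt_succ_iff]
    by_contra hlt
    exact hm0 (MvPolynomial.homogeneousComponent_eq_zero _ _ (not_le.1 hlt))

section

variable {K W : Type*} [Field K] [AddCommGroup W] [Module K W]

/-- A lower bound on the rank is witnessed by a nonzero minor. -/
lemma exists_compression_det_ne_zero (f : W →ₗ[K] W) {r : ℕ}
    (hr : r ≤ Module.finrank K (LinearMap.range f)) :
    ∃ (L : (Fin r → K) →ₗ[K] W) (R : W →ₗ[K] (Fin r → K)),
      (LinearMap.toMatrix' (R ∘ₗ f ∘ₗ L)).det ≠ 0 := by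
  obtain ⟨b, hb⟩ := exists_linearIndependent_of_le_finrank hr
  choose w hw using fun i => (b i).2
  let L : (Fin r → K) →ₗ[K] W := Fintype.linearCombination K w
  have hfL : f ∘ₗ L = (LinearMap.range f).subtype ∘ₗ Fintype.linearCombination K b := by
    ext i
    simp [L, hw]
  have hinj : LinearMap.ker (f ∘ₗ L) = ⊥ := by
    rw [LinearMap.ker_eq_bot, hfL, LinearMap.coe_comp]
    exact (Submodule.injective_subtype _).comp
      (linearIndependent_iff_injective_fintypeLinearCombination.1 hb)
  obtain ⟨R, hR⟩ := LinearMap.exists_leftInverse_of_injective _ hinj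
  refine ⟨L, R, ?_⟩
  rw [hR, LinearMap.toMatrix'_id, Matrix.det_one]
  exact one_ne_zero

lemma le_finrank_range_of_compression_det_ne_zero [FiniteDimensional K W] (f : W →ₗ[K] W) {r : ℕ}
    (L : (Fin r → K) →ₗ[K] W) (R : W →ₗ[K] (Fin r → K))
    (hdet : (LinearMap.toMatrix' (R ∘ₗ f ∘ₗ L)).det ≠ 0) :
    r ≤ Module.finrank K (LinearMap.range f) := by
  have hinj : Function.Injective (R ∘ₗ f ∘ₗ L) := by
    rw [LinearMap.det_toMatrix'] at hdet
    rw [← LinearMap.ker_eq_bot]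
    by_contra hker
    exact hdet (LinearMap.det_eq_zero_iff_ker_ne_bot.2 hker)
  have hinj' : Function.Injective (f ∘ₗ L) := by
    rw [LinearMap.coe_comp] at hinj
    exact hinj.of_comp
  have h1 := LinearMap.finrank_range_of_inj hinj'
  rw [Module.finrank_fin_fun] at h1
  rw [← h1]
  exact Submodule.finrank_mono (LinearMap.range_comp_le_range _ _)

/-- In a family of endomorphisms depending affinely on parameters, a lower bound for the dimension
of the kernel holds everywhere if it holds on curves through one point with all tangent vectors. -/
lemma le_finrank_ker_of_curves [FiniteDimensional K W] [Infinite K] {σ : Type*} [Fintype σ]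
    [DecidableEq σ] (f₀ : W →ₗ[K] W) (Λ : (σ → K) →ₗ[K] W →ₗ[K] W) (F₀ : σ → K) (g : ℕ)
    (h : ∀ v : σ → K, ∃ p : σ → Polynomial K,
      (∀ i, (p i).coeff 0 = F₀ i ∧ (p i).coeff 1 = v i) ∧
      {s : K | g ≤ Module.finrank K
        (LinearMap.ker (f₀ + Λ fun i => (p i).eval s))}.Infinite) (F : σ → K) :
    g ≤ Module.finrank K (LinearMap.ker (f₀ + Λ F)) := by
  by_contra hlt
  have hrn : ∀ G, Module.finrank K (LinearMap.range (f₀ + Λ G)) +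
      Module.finrank K (LinearMap.ker (f₀ + Λ G)) = Module.finrank K W :=
    fun G => LinearMap.finrank_range_add_finrank_ker _
  obtain ⟨L, R, hdet⟩ := exists_compression_det_ne_zero (f₀ + Λ F)
    (r := Module.finrank K W + 1 - g) (by have := hrn F; omega)
  -- The minor given by `L` and `R`, as a polynomial in the parameters.
  let M : Matrix (Fin (Module.finrank K W + 1 - g)) (Fin (Module.finrank K W + 1 - g))
      (MvPolynomial σ K) := Matrix.of fun k l =>
    MvPolynomial.C (R (f₀ (L (Pi.single l 1))) k) +
      ∑ i, MvPolynomial.C (R (Λ (Pi.single i 1) (L (Pi.single l 1))) k) * MvPolynomial.X i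
  have hM : ∀ G : σ → K, MvPolynomial.eval G M.det =
      (LinearMap.toMatrix' (R ∘ₗ (f₀ + Λ G) ∘ₗ L)).det := by
    intro G
    rw [RingHom.map_det]
    congr 1
    ext k l
    have hG : Λ G = ∑ i, G i • Λ (Pi.single i 1) := by
      conv_lhs => rw [pi_eq_sum_univ' G]
      rw [map_sum]
      refine Finset.sum_congr rfl fun i _ => ?_
      rw [map_smul]
    simp only [RingHom.mapMatrix_apply, Matrix.map_apply, M, Matrix.of_apply, map_add, map_sum,
      map_mul, MvPolynomial.eval_C, MvPolynomial.eval_X, LinearMap.toMatrix'_apply,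
      LinearMap.comp_apply, LinearMap.add_apply, hG, LinearMap.sum_apply, LinearMap.smul_apply,
      map_smul, Pi.add_apply, Finset.sum_apply, Pi.smul_apply, smul_eq_mul]
    congr 1
    exact Finset.sum_congr rfl fun i _ => mul_comm _ _
  have hzero : M.det = 0 := by
    refine MvPolynomial.eq_zero_of_vanishes_on_curves _ F₀ fun v => ?_
    obtain ⟨p, hp, hinf⟩ := h v
    refine ⟨p, hp, Polynomial.eq_zero_of_infinite_isRoot _ (hinf.mono fun s hs => ?_)⟩
    have e : (MvPolynomial.aeval p M.det).eval s =
        MvPolynomial.eval (fun i => (p i).eval s) M.det := by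
      rw [← Polynomial.coe_aeval_eq_eval, ← AlgHom.comp_apply, MvPolynomial.comp_aeval,
        ← MvPolynomial.coe_aeval_eq_eval]
      rfl
    change (MvPolynomial.aeval p M.det).eval s = 0
    rw [e, hM]
    by_contra hne
    have h1 := le_finrank_range_of_compression_det_ne_zero _ L R hne
    have h2 := hrn fun i => (p i).eval s
    have h3 : g ≤ _ := hs
    omega
  apply hdet
  rw [← hM, hzero, map_zero]

end

/-! ### From block diagonal functionals to all functionals -/

section

variable {K : Type*} [Field K] {n a c : ℕ}

lemma exists_trace_mul_eq (f : Module.Dual K (Matrix (Fin n) (Fin n) K)) :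
    ∃ x : Matrix (Fin n) (Fin n) K, ∀ m, f m = (x * m).trace := by
  refine ⟨Matrix.of fun i j => f (Matrix.single j i 1), fun m => ?_⟩
  conv_lhs => rw [Matrix.matrix_eq_sum_single m]
  rw [map_sum, Matrix.trace, Finset.sum_congr rfl fun i _ => map_sum f _ _, Finset.sum_comm]
  refine Finset.sum_congr rfl fun j _ => ?_
  rw [Matrix.diag_apply, Matrix.mul_apply]
  refine Finset.sum_congr rfl fun i _ => ?_
  rw [Matrix.of_apply, ← mul_one (m i j), ← smul_eq_mul, ← Matrix.smul_single, map_smul,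
    smul_eq_mul, mul_comm, smul_eq_mul, mul_one]

/-- The functionals whose restriction to the seaweed algebra is block diagonal with respect to the
components of the meander. -/
def blockDiagonalForms (K : Type*) [Field K] (n a c : ℕ) :
    Submodule K (Matrix (Fin n) (Fin n) K) where
  carrier := {F | ∀ i j : Fin n,
    Allowed a c j i → component n a c i ≠ component n a c j → F i j = 0}
  add_mem' := by
    intro x y hx hy i j hij hne
    rw [Matrix.add_apply, hx i j hij hne, hy i j hij hne, add_zero]
  zero_mem' := fun _ _ _ _ => rfl
  smul_mem' := by
    intro r x hx i j hij hne
    rw [Matrix.smul_apply, hx i j hij hne, smul_zero]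

lemma meanderMatrix_mem_blockDiagonalForms (ha : a ≤ n) (hc : c ≤ n) :
    meanderMatrix K n a c ∈ blockDiagonalForms K n a c := by
  intro i j _ hne
  rw [meanderMatrix, Matrix.of_apply, if_neg, if_neg, add_zero]
  · rintro ⟨-, h⟩
    rw [h] at hne
    exact hne (component_flip_bottom hc j.2)
  · rintro ⟨-, h⟩
    rw [h] at hne
    exact hne (component_flip_top ha j.2)

/-- The block diagonal functionals are transversal to the coadjoint orbit of the meander functional:
the orthogonal of the sum of the two spaces consists of elements of the kernel of the meander form
that vanish on the diagonal blocks. -/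
lemma exists_commutator_add_blockDiagonal [CharZero K] (ha : a ≤ n) (hc : c ≤ n)
    (v : Matrix (Fin n) (Fin n) K) :
    ∃ y ∈ seaweedAlg K n a c, ∃ t ∈ blockDiagonalForms K n a c,
      v = y * meanderMatrix K n a c - meanderMatrix K n a c * y + t := by
  set F := meanderMatrix K n a c with hF
  let ad : Matrix (Fin n) (Fin n) K →ₗ[K] Matrix (Fin n) (Fin n) K :=
    LinearMap.mulRight K F - LinearMap.mulLeft K F
  suffices h : (Subalgebra.toSubmodule (seaweedAlg K n a c)).map ad ⊔ blockDiagonalForms K n a c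
      = ⊤ by
    obtain ⟨u, hu, t, ht, rfl⟩ := Submodule.mem_sup.1 (h ▸ Submodule.mem_top : v ∈ _)
    obtain ⟨y, hy, rfl⟩ := hu
    exact ⟨y, hy, t, ht, rfl⟩
  by_contra hne
  obtain ⟨f, hf0, hf⟩ := Submodule.exists_le_ker_of_lt_top _ (lt_top_iff_ne_top.2 hne)
  obtain ⟨x, hx⟩ := exists_trace_mul_eq f
  have hsingle : ∀ i j, f (Matrix.single i j 1) = x j i := by
    intro i j
    rw [hx, Matrix.trace_mul_single, MulOpposite.op_one, one_smul]
  have hT : ∀ t ∈ blockDiagonalForms K n a c, f t = 0 := fun t ht =>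
    hf (Submodule.mem_sup_right ht)
  have hA : x ∈ seaweedAlg K n a c := by
    intro i j hij
    rw [← hsingle]
    apply hT
    intro p q hpq hne
    rw [Matrix.single_apply, if_neg]
    rintro ⟨rfl, rfl⟩
    exact hij hpq
  have hdiag : ∀ i j : Fin n, component n a c i = component n a c j → x i j = 0 := by
    intro i j hij
    rw [← hsingle]
    apply hT
    intro p q hpq hne
    rw [Matrix.single_apply, if_neg]
    rintro ⟨rfl, rfl⟩
    exact hne hij.symm
  have hstab : x ∈ stab a c F := by
    refine ⟨hA, fun y hy => ?_⟩
    have h1 : f (y * F - F * y) = 0 := hf (Submodule.mem_sup_left ⟨y, hy, rfl⟩)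
    rw [hx, mul_sub, Matrix.trace_sub, ← mul_assoc, Matrix.trace_mul_comm (x * y) F,
      Matrix.trace_mul_comm x, mul_assoc F y x] at h1
    rw [mul_sub, Matrix.trace_sub, h1]
  apply hf0
  ext m
  rw [hx, show x = 0 from ?_, zero_mul, Matrix.trace_zero, LinearMap.zero_apply]
  ext i j
  by_cases hij : component n a c i = component n a c j
  · exact hdiag i j hij
  · exact apply_eq_zero_of_component_ne ha hc hstab hij

lemma inv_mem_seaweedAlg {u : Matrix (Fin n) (Fin n) K} (hu : u ∈ seaweedAlg K n a c)
    (hdet : IsUnit u.det) : u⁻¹ ∈ seaweedAlg K n a c := by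
  let f : seaweedAlg K n a c →ₗ[K] seaweedAlg K n a c := LinearMap.mulLeft K ⟨u, hu⟩
  have hinj : Function.Injective f := by
    intro x y hxy
    have h1 : u * x.1 = u * y.1 := congrArg Subtype.val hxy
    have h2 := congrArg (u⁻¹ * ·) h1
    simp only [Matrix.nonsing_inv_mul_cancel_left _ _ hdet] at h2
    exact Subtype.ext h2
  obtain ⟨w, hw⟩ := (LinearMap.injective_iff_surjective.1 hinj) 1
  have h1 : u * w.1 = 1 := congrArg Subtype.val hw
  rw [Matrix.inv_eq_right_inv h1]
  exact w.2

/-- Conjugating a functional by an invertible element of the seaweed algebra and rescaling it does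
not decrease the dimension of the kernel. -/
lemma finrank_stab_le_finrank_stab_conj (F : Matrix (Fin n) (Fin n) K)
    {u : Matrix (Fin n) (Fin n) K} (hu : u ∈ seaweedAlg K n a c) (hdet : u.det ≠ 0) :
    Module.finrank K (stab a c F) ≤ Module.finrank K (stab a c (u * F * u.adjugate)) := by
  have hunit : IsUnit u.det := isUnit_iff_ne_zero.2 hdet
  have hinv := inv_mem_seaweedAlg hu hunit
  have huu : u⁻¹ * u = 1 := Matrix.nonsing_inv_mul _ hunit
  have hadj : u.adjugate = u.det • u⁻¹ := by
    rw [Matrix.inv_def, smul_smul, Ring.mul_inverse_cancel _ hunit, one_smul]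
  let conj : Matrix (Fin n) (Fin n) K →ₗ[K] Matrix (Fin n) (Fin n) K :=
    LinearMap.mulRight K u⁻¹ ∘ₗ LinearMap.mulLeft K u
  have hconj : ∀ x, conj x = u * x * u⁻¹ := fun x => rfl
  have hmap : ∀ x ∈ stab a c F, conj x ∈ stab a c (u * F * u.adjugate) := by
    intro x hx
    rw [hconj]
    refine ⟨mul_mem (mul_mem hu hx.1) hinv, fun y hy => ?_⟩
    have h1 := hx.2 _ (mul_mem (mul_mem hinv hy) hu)
    have e : u * F * u.adjugate * (u * x * u⁻¹ * y - y * (u * x * u⁻¹)) =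
        u.det • (u * (F * (x * (u⁻¹ * y * u) - u⁻¹ * y * u * x)) * u⁻¹) := by
      have h2 : u * F * (u⁻¹ * (u * x * u⁻¹ * y - y * (u * x * u⁻¹))) =
          u * (F * (x * (u⁻¹ * y * u) - u⁻¹ * y * u * x)) * u⁻¹ := by
        have h3 : u * u⁻¹ = 1 := Matrix.mul_nonsing_inv _ hunit
        have h4 : u⁻¹ * (u * x * u⁻¹ * y - y * (u * x * u⁻¹)) =
            (u⁻¹ * u) * x * u⁻¹ * y - u⁻¹ * y * u * x * u⁻¹ := by noncomm_ring
        have h5 : (x * (u⁻¹ * y * u) - u⁻¹ * y * u * x) * u⁻¹ =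
            x * u⁻¹ * y * (u * u⁻¹) - u⁻¹ * y * u * x * u⁻¹ := by noncomm_ring
        rw [mul_assoc u (F * _) u⁻¹, mul_assoc F _ u⁻¹, h4, h5, huu, h3, one_mul, mul_one,
          ← mul_assoc u F]
      rw [hadj, mul_smul_comm, smul_mul_assoc, mul_assoc (u * F), h2]
    rw [e, Matrix.trace_smul, Matrix.trace_mul_comm, ← mul_assoc, huu, one_mul, h1, smul_zero]
  refine LinearMap.finrank_le_finrank_of_injective (f := conj.restrict hmap) ?_
  intro x y hxy
  have h1 : u * x.1 * u⁻¹ = u * y.1 * u⁻¹ := congrArg Subtype.val hxy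
  have h2 := congrArg (fun m => u⁻¹ * (m * u)) h1
  simp only [Matrix.nonsing_inv_mul_cancel_right _ _ hunit,
    Matrix.nonsing_inv_mul_cancel_left _ _ hunit] at h2
  exact Subtype.ext h2

/-- The polynomial curve `s ↦ u (F + s t) adj u`, `u = 1 + s y`, of rescaled conjugates. -/
noncomputable def conjCurve (F t y : Matrix (Fin n) (Fin n) K) :
    Matrix (Fin n) (Fin n) (Polynomial K) :=
  (1 + (Polynomial.X : Polynomial K) • y.map Polynomial.C) *
    (F.map Polynomial.C + (Polynomial.X : Polynomial K) • t.map Polynomial.C) *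
    (1 + (Polynomial.X : Polynomial K) • y.map Polynomial.C).adjugate

lemma matPolyEquiv_affine (F t : Matrix (Fin n) (Fin n) K) :
    matPolyEquiv (F.map Polynomial.C + (Polynomial.X : Polynomial K) • t.map Polynomial.C) =
      Polynomial.C F + Polynomial.X * Polynomial.C t := by
  rw [map_add, matPolyEquiv_map_smul, matPolyEquiv_map_C, matPolyEquiv_map_C, Polynomial.map_X]

lemma map_one_C : (1 : Matrix (Fin n) (Fin n) K).map Polynomial.C = 1 := by
  rw [Matrix.map_one _ (map_zero _) (map_one _)]

lemma coeff_conjCurve (F t y : Matrix (Fin n) (Fin n) K) :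
    (matPolyEquiv (conjCurve F t y)).coeff 0 = F ∧
      (matPolyEquiv (conjCurve F t y)).coeff 1 = y * F - F * y + t +
        (1 + (Polynomial.X : Polynomial K) • y.map Polynomial.C).det.coeff 1 • F := by
  have hu := matPolyEquiv_affine 1 y
  rw [map_one_C] at hu
  obtain ⟨u, hudef⟩ : ∃ u, u = (1 : Matrix (Fin n) (Fin n) (Polynomial K)) +
    (Polynomial.X : Polynomial K) • y.map Polynomial.C := ⟨_, rfl⟩
  have hadj := congrArg matPolyEquiv (Matrix.mul_adjugate u)
  rw [map_mul, matPolyEquiv_smul_one] at hadj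
  rw [conjCurve, ← hudef, map_mul, map_mul, matPolyEquiv_affine]
  rw [← hudef] at hu
  rw [hu] at hadj ⊢
  have hdet0 : u.det.coeff 0 = 1 := by
    rw [Polynomial.coeff_zero_eq_eval_zero, ← Polynomial.coe_evalRingHom, RingHom.map_det, hudef]
    rw [show (Polynomial.evalRingHom (0 : K)).mapMatrix
      (1 + (Polynomial.X : Polynomial K) • y.map Polynomial.C) = 1 from ?_, Matrix.det_one]
    ext i j
    simp [Matrix.one_apply, apply_ite]
  set B := matPolyEquiv u.adjugate with hB
  have hB0 : B.coeff 0 = 1 := by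
    have := congrArg (fun p => Polynomial.coeff p 0) hadj
    simpa [Polynomial.mul_coeff_zero, hdet0] using this
  have hB1 : y + B.coeff 1 = u.det.coeff 1 • 1 := by
    have := congrArg (fun p => Polynomial.coeff p 1) hadj
    simpa [Polynomial.mul_coeff_one, Polynomial.mul_coeff_zero, hB0, add_comm, Polynomial.coeff_one,
      Algebra.algebraMap_eq_smul_one] using this
  have hB1' : B.coeff 1 = u.det.coeff 1 • 1 - y := by rw [← hB1, add_sub_cancel_left]
  refine ⟨by simp [Polynomial.mul_coeff_zero, hB0], ?_⟩
  simp only [Polynomial.mul_coeff_one, Polynomial.mul_coeff_zero, Polynomial.coeff_add, hB0, hB1']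
  simp [mul_sub, Polynomial.coeff_one]
  abel

lemma map_eval_conjCurve (F t y : Matrix (Fin n) (Fin n) K) (s : K) :
    (conjCurve F t y).map (Polynomial.eval s) =
      (1 + s • y) * (F + s • t) * (1 + s • y).adjugate := by
  have h : ∀ A B : Matrix (Fin n) (Fin n) K, (Polynomial.evalRingHom s).mapMatrix
      (A.map Polynomial.C + (Polynomial.X : Polynomial K) • B.map Polynomial.C) = A + s • B := by
    intro A B
    ext i j
    simp [mul_comm s]
  have h1 := h 1 y
  rw [map_one_C] at h1
  have : (conjCurve F t y).map (Polynomial.eval s) =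
    (Polynomial.evalRingHom s).mapMatrix (conjCurve F t y) := rfl
  rw [this, conjCurve, map_mul, map_mul, RingHom.map_adjugate, h, h1]

/-- The lower bound for the dimension of the kernel propagates from the block diagonal functionals
to all functionals, since the conjugates of the former sweep out every direction at the meander
functional. -/
lemma rotGcd_le_finrank_stab [CharZero K] (hn : 0 < n) (ha : a ≤ n) (hc : c ≤ n)
    (F : Matrix (Fin n) (Fin n) K) : rotGcd n a c ≤ Module.finrank K (stab a c F) := by
  classical
  let f₀ : Matrix (Fin n) (Fin n) K →ₗ[K] Matrix (Fin n) (Fin n) K :=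
    { toFun := fun x => Matrix.of fun i j => if Allowed a c i j then 0 else x i j
      map_add' := by
        intro x y; ext i j
        simp only [Matrix.of_apply, Matrix.add_apply]
        split_ifs <;> simp
      map_smul' := by
        intro r x; ext i j
        simp only [Matrix.of_apply, Matrix.smul_apply, RingHom.id_apply]
        split_ifs <;> simp }
  let mat : (Fin n × Fin n → K) →ₗ[K] Matrix (Fin n) (Fin n) K :=
    { toFun := fun G => Matrix.of fun i j => G (i, j)
      map_add' := fun _ _ => rfl
      map_smul' := fun _ _ => rfl }
  let Λ : (Fin n × Fin n → K) →ₗ[K] Matrix (Fin n) (Fin n) K →ₗ[K] Matrix (Fin n) (Fin n) K :=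
    LinearMap.mk₂ K (fun G x => Matrix.of fun i j =>
        if Allowed a c i j then (mat G * x - x * mat G) j i else 0)
      (fun G G' x => by
        ext i j
        simp only [Matrix.of_apply, Matrix.add_apply, map_add, add_mul, mul_add, Matrix.sub_apply]
        split_ifs <;> ring)
      (fun r G x => by
        ext i j
        simp only [Matrix.of_apply, Matrix.smul_apply, map_smul, smul_mul_assoc, mul_smul_comm,
          Matrix.sub_apply, smul_eq_mul]
        split_ifs <;> ring)
      (fun G x x' => by
        ext i j
        simp only [Matrix.of_apply, Matrix.add_apply, add_mul, mul_add, Matrix.sub_apply]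
        split_ifs <;> ring)
      (fun r G x => by
        ext i j
        simp only [Matrix.of_apply, Matrix.smul_apply, smul_mul_assoc, mul_smul_comm,
          Matrix.sub_apply, smul_eq_mul]
        split_ifs <;> ring)
  have hker : ∀ G, LinearMap.ker (f₀ + Λ G) = stab a c (mat G) := by
    intro G
    ext x
    have happ : ∀ i j : Fin n, (f₀ + Λ G) x i j =
        if Allowed a c i j then (mat G * x - x * mat G) j i else x i j := by
      intro i j
      change (if Allowed a c i j then 0 else x i j) +
        (if Allowed a c i j then (mat G * x - x * mat G) j i else 0) = _
      split_ifs <;> simp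
    rw [LinearMap.mem_ker]
    constructor
    · intro hx
      have hx' : ∀ i j : Fin n,
          (if Allowed a c i j then (mat G * x - x * mat G) j i else x i j) = 0 := by
        intro i j
        rw [← happ, hx, Matrix.zero_apply]
      refine ⟨fun i j hij => by simpa [hij] using hx' i j, fun y hy => ?_⟩
      rw [trace_mul_commutator, Matrix.trace]
      refine Finset.sum_eq_zero fun j _ => ?_
      rw [Matrix.diag_apply, Matrix.mul_apply]
      refine Finset.sum_eq_zero fun i _ => ?_
      by_cases hij : Allowed a c i j
      · have := hx' i j
        rw [if_pos hij] at this
        rw [this, zero_mul]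
      · rw [hy i j hij, mul_zero]
    · intro hx
      ext i j
      rw [happ, Matrix.zero_apply]
      split_ifs with hij
      · rw [Matrix.sub_apply, commutator_apply_of_mem_stab hx hij, sub_self]
      · exact hx.1 i j hij
  have hF : F = mat fun p => F p.1 p.2 := rfl
  rw [hF, ← hker]
  refine le_finrank_ker_of_curves f₀ Λ (fun p => meanderMatrix K n a c p.1 p.2) _ (fun v => ?_) _
  obtain ⟨y, hy, t, ht, hv⟩ := exists_commutator_add_blockDiagonal ha hc (mat v)
  set D := (1 + (Polynomial.X : Polynomial K) • y.map Polynomial.C).det with hD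
  have hDs : ∀ s, D.eval s = (1 + s • y).det := by
    intro s
    rw [hD, ← Polynomial.coe_evalRingHom, RingHom.map_det]
    congr 1
    ext i j
    simp [Matrix.one_apply, apply_ite (Polynomial.eval s), mul_comm s]
  have hD0 : D ≠ 0 := by
    intro h0
    have := hDs 0
    simp [h0] at this
  set d := D.coeff 1 with hd
  -- The multiple of the meander functional cancels the first-order term of the determinant factor.
  set t' := t - d • meanderMatrix K n a c with ht'
  have ht'mem : t' ∈ blockDiagonalForms K n a c :=
    sub_mem ht (Submodule.smul_mem _ _ (meanderMatrix_mem_blockDiagonalForms ha hc))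
  refine ⟨fun p => conjCurve (meanderMatrix K n a c) t' y p.1 p.2, fun p => ⟨?_, ?_⟩, ?_⟩
  · rw [← matPolyEquiv_coeff_apply, (coeff_conjCurve _ _ _).1]
  · have e : y * meanderMatrix K n a c - meanderMatrix K n a c * y + t' +
        d • meanderMatrix K n a c = mat v := by
      rw [hv, ht']
      abel
    rw [← matPolyEquiv_coeff_apply, (coeff_conjCurve _ _ _).2, ← hD, ← hd, e]
    rfl
  · have hfin : {s : K | (1 + s • y).det = 0}.Finite := by
      refine (Polynomial.finite_setOfPred_isRoot hD0).subset fun s hs => ?_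
      exact (hDs s).trans hs
    refine hfin.infinite_compl.mono fun s hs => ?_
    rw [Set.mem_ofPred_eq, hker]
    have e : mat (fun p => (conjCurve (meanderMatrix K n a c) t' y p.1 p.2).eval s) =
        (1 + s • y) * (meanderMatrix K n a c + s • t') * (1 + s • y).adjugate := by
      rw [← map_eval_conjCurve]
      rfl
    rw [e]
    refine le_trans ?_ (finrank_stab_le_finrank_stab_conj _
      (add_mem (one_mem _) (Subalgebra.smul_mem _ hy s)) hs)
    exact rotGcd_le_finrank_stab_of_blockDiagonal hn ha hc
      (add_mem (meanderMatrix_mem_blockDiagonalForms ha hc) (Submodule.smul_mem _ _ ht'mem))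

end

/-! ### The index of the seaweed algebra -/

section

variable {K : Type*} [Field K] {n : ℕ}

lemma mem_headSpan {m : ℕ} {v : Fin n → K} :
    v ∈ headSpan K n m ↔ ∀ i : Fin n, m ≤ (i : ℕ) → v i = 0 := by
  constructor
  · intro hv i hi
    induction hv using Submodule.span_induction with
    | mem x hx =>
      obtain ⟨j, hj, rfl⟩ := hx
      exact Pi.single_eq_of_ne (by rintro rfl; omega) _
    | zero => rfl
    | add x y _ _ hx hy => rw [Pi.add_apply, hx, hy, add_zero]
    | smul r x _ hx => rw [Pi.smul_apply, hx, smul_zero]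
  · intro hv
    rw [pi_eq_sum_univ' v]
    refine Submodule.sum_mem _ fun i _ => ?_
    by_cases hi : (i : ℕ) < m
    · refine Submodule.smul_mem _ _ (Submodule.subset_span ⟨i, hi, ?_⟩)
      rfl
    · rw [hv i (not_lt.1 hi), zero_smul]
      exact Submodule.zero_mem _

lemma mem_tailSpan {m : ℕ} {v : Fin n → K} :
    v ∈ tailSpan K n m ↔ ∀ i : Fin n, (i : ℕ) < m → v i = 0 := by
  constructor
  · intro hv i hi
    induction hv using Submodule.span_induction with
    | mem x hx =>
      obtain ⟨j, hj, rfl⟩ := hx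
      exact Pi.single_eq_of_ne (by rintro rfl; omega) _
    | zero => rfl
    | add x y _ _ hx hy => rw [Pi.add_apply, hx, hy, add_zero]
    | smul r x _ hx => rw [Pi.smul_apply, hx, smul_zero]
  · intro hv
    rw [pi_eq_sum_univ' v]
    refine Submodule.sum_mem _ fun i _ => ?_
    by_cases hi : (i : ℕ) < m
    · rw [hv i hi, zero_smul]
      exact Submodule.zero_mem _
    · refine Submodule.smul_mem _ _ (Submodule.subset_span ⟨i, not_lt.1 hi, ?_⟩)
      rfl

lemma mulVec_mem_headSpan_iff {m : ℕ} {A : Matrix (Fin n) (Fin n) K} :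
    (∀ v ∈ headSpan K n m, A *ᵥ v ∈ headSpan K n m) ↔
      ∀ i j : Fin n, m ≤ (i : ℕ) → (j : ℕ) < m → A i j = 0 := by
  constructor
  · intro h i j hi hj
    have := mem_headSpan.1 (h (Pi.single j 1) (Submodule.subset_span ⟨j, hj, rfl⟩)) i hi
    rwa [Matrix.mulVec_single_one] at this
  · intro h v hv
    rw [mem_headSpan] at hv ⊢
    intro i hi
    change ∑ j, A i j * v j = 0
    refine Finset.sum_eq_zero fun j _ => ?_
    by_cases hj : (j : ℕ) < m
    · rw [h i j hi hj, zero_mul]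
    · rw [hv j (not_lt.1 hj), mul_zero]

lemma mulVec_mem_tailSpan_iff {m : ℕ} {A : Matrix (Fin n) (Fin n) K} :
    (∀ v ∈ tailSpan K n m, A *ᵥ v ∈ tailSpan K n m) ↔
      ∀ i j : Fin n, (i : ℕ) < m → m ≤ (j : ℕ) → A i j = 0 := by
  constructor
  · intro h i j hi hj
    have := mem_tailSpan.1 (h (Pi.single j 1) (Submodule.subset_span ⟨j, hj, rfl⟩)) i hi
    rwa [Matrix.mulVec_single_one] at this
  · intro h v hv
    rw [mem_tailSpan] at hv ⊢
    intro i hi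
    change ∑ j, A i j * v j = 0
    refine Finset.sum_eq_zero fun j _ => ?_
    by_cases hj : (j : ℕ) < m
    · rw [hv j hj, mul_zero]
    · rw [h i j hi (not_lt.1 hj), zero_mul]

lemma mem_seaweed_iff {p q : Composition n} (hp : p.length = 2) (hq : q.length = 2)
    {A : LieAlgebra.SpecialLinear.sl (Fin n) K} :
    A ∈ seaweed K p q ↔ A.1 ∈ seaweedAlg K n (p.sizeUpTo 1) (q.sizeUpTo 1) := by
  have hp2 : p.sizeUpTo 2 = n := by rw [← hp, p.sizeUpTo_length]
  have hq2 : q.sizeUpTo 2 = n := by rw [← hq, q.sizeUpTo_length]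
  change ((∀ i ≤ p.length, ∀ v ∈ headSpan K n (p.sizeUpTo i),
      A.1 *ᵥ v ∈ headSpan K n (p.sizeUpTo i)) ∧
    (∀ j ≤ q.length, ∀ v ∈ tailSpan K n (q.sizeUpTo j),
      A.1 *ᵥ v ∈ tailSpan K n (q.sizeUpTo j))) ↔ _
  simp only [mulVec_mem_headSpan_iff, mulVec_mem_tailSpan_iff, mem_seaweedAlg]
  constructor
  · rintro ⟨h1, h2⟩ i j hij
    unfold Allowed at hij
    by_cases h : (i : ℕ) < p.sizeUpTo 1 ∨ p.sizeUpTo 1 ≤ j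
    · exact h2 1 (by omega) i j (by omega) (by omega)
    · exact h1 1 (by omega) i j (by omega) (by omega)
  · intro h
    refine ⟨fun l hl i j hi hj => ?_, fun l hl i j hi hj => ?_⟩
    · rw [hp] at hl
      interval_cases l
      · rw [p.sizeUpTo_zero] at hj
        omega
      · exact h i j (by unfold Allowed; omega)
      · omega
    · rw [hq] at hl
      interval_cases l
      · rw [q.sizeUpTo_zero] at hi
        omega
      · exact h i j (by unfold Allowed; omega)
      · omega

/-- The functional `x ↦ tr (F x)` on a seaweed algebra. -/
def traceForm (F : Matrix (Fin n) (Fin n) K) (p q : Composition n) :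
    Module.Dual K (seaweed K p q) where
  toFun x := (F * x.1.1).trace
  map_add' x y := by
    rw [← Matrix.trace_add, ← mul_add]
    rfl
  map_smul' r x := by
    rw [RingHom.id_apply, ← Matrix.trace_smul, ← mul_smul_comm]
    rfl

lemma exists_eq_traceForm {p q : Composition n} (f : Module.Dual K (seaweed K p q)) :
    ∃ F, f = traceForm F p q := by
  let ι : seaweed K p q →ₗ[K] Matrix (Fin n) (Fin n) K :=
    { toFun := fun x => x.1.1
      map_add' := fun _ _ => rfl
      map_smul' := fun _ _ => rfl }
  have hι : Function.Injective ι := fun x y h => Subtype.ext (Subtype.ext h)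
  obtain ⟨f', rfl⟩ := LinearMap.dualMap_surjective_of_injective hι f
  obtain ⟨F, hF⟩ := exists_trace_mul_eq f'
  exact ⟨F, LinearMap.ext fun x => hF _⟩

/-- Passing from the seaweed algebra in `gl n` to the one in `sl n` removes the scalar matrices from
the kernel. -/
lemma finrank_ker_kirillovForm_add_one [CharZero K] (hn : 0 < n) {p q : Composition n}
    (hp : p.length = 2) (hq : q.length = 2) (F : Matrix (Fin n) (Fin n) K) :
    Module.finrank K (LinearMap.ker (kirillovForm (traceForm F p q))) + 1 =
      Module.finrank K (stab (p.sizeUpTo 1) (q.sizeUpTo 1) F) := by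
  have hn0 : (n : K) ≠ 0 := Nat.cast_ne_zero.2 hn.ne'
  have htr1 : (1 : Matrix (Fin n) (Fin n) K).trace = n := by
    rw [Matrix.trace_one, Fintype.card_fin]
  let T : stab (p.sizeUpTo 1) (q.sizeUpTo 1) F →ₗ[K] K :=
    (Matrix.traceLinearMap (Fin n) K K).domRestrict _
  have hker : ∀ x : seaweed K p q, x ∈ LinearMap.ker (kirillovForm (traceForm F p q)) ↔
      x.1.1 ∈ stab (p.sizeUpTo 1) (q.sizeUpTo 1) F := by
    intro x
    have hform : ∀ y : seaweed K p q, kirillovForm (traceForm F p q) x y =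
        (F * (x.1.1 * y.1.1 - y.1.1 * x.1.1)).trace := fun y => rfl
    constructor
    · intro hx
      refine ⟨(mem_seaweed_iff hp hq).1 x.2, fun y hy => ?_⟩
      set y₀ : Matrix (Fin n) (Fin n) K := y - (y.trace / n) • 1 with hy₀
      have hy₀tr : y₀ ∈ LieAlgebra.SpecialLinear.sl (Fin n) K := by
        change y₀.trace = 0
        rw [hy₀, Matrix.trace_sub, Matrix.trace_smul, htr1, smul_eq_mul, div_mul_cancel₀ _ hn0,
          sub_self]
      have hy₀mem : (⟨y₀, hy₀tr⟩ : LieAlgebra.SpecialLinear.sl (Fin n) K) ∈ seaweed K p q :=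
        (mem_seaweed_iff hp hq).2 (sub_mem hy (Subalgebra.smul_mem _ (one_mem _) _))
      have h := hform ⟨⟨y₀, hy₀tr⟩, hy₀mem⟩
      rw [LinearMap.mem_ker.1 hx] at h
      have e : x.1.1 * y - y * x.1.1 = x.1.1 * y₀ - y₀ * x.1.1 := by
        rw [hy₀, mul_sub, sub_mul, mul_smul_comm, smul_mul_assoc, mul_one, one_mul]
        abel
      rw [e]
      exact h.symm
    · intro hx
      rw [LinearMap.mem_ker]
      ext y
      rw [hform]
      exact hx.2 _ ((mem_seaweed_iff hp hq).1 y.2)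
  let e : LinearMap.ker T ≃ₗ[K] LinearMap.ker (kirillovForm (traceForm F p q)) :=
    { toFun := fun x => ⟨⟨⟨x.1.1, x.2⟩, (mem_seaweed_iff hp hq).2 x.1.2.1⟩, (hker _).2 x.1.2⟩
      map_add' := fun _ _ => rfl
      map_smul' := fun _ _ => rfl
      invFun := fun x => ⟨⟨x.1.1.1, (hker _).1 x.2⟩, x.1.1.2⟩
      left_inv := fun _ => rfl
      right_inv := fun _ => rfl }
  have hsurj : LinearMap.range T = ⊤ := by
    rw [LinearMap.range_eq_top]
    intro r
    refine ⟨(r / n) • ⟨1, one_mem _, fun y _ => by simp⟩, ?_⟩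
    change ((r / (n : K)) • (1 : Matrix (Fin n) (Fin n) K)).trace = r
    rw [Matrix.trace_smul, htr1, smul_eq_mul, div_mul_cancel₀ _ hn0]
  have h := LinearMap.finrank_range_add_finrank_ker T
  rw [hsurj, finrank_top, Module.finrank_self, e.finrank_eq] at h
  omega

/-- The index of the seaweed algebra of type `a|n-a / c|n-c` is `gcd(n, c - a) - 1`. -/
theorem lieIndex_seaweed_add_one [CharZero K] (hn : 0 < n) {p q : Composition n}
    (hp : p.length = 2) (hq : q.length = 2) :
    lieIndex K (seaweed K p q) + 1 = rotGcd n (p.sizeUpTo 1) (q.sizeUpTo 1) := by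
  have ha := p.sizeUpTo_le 1
  have hc := q.sizeUpTo_le 1
  apply le_antisymm
  · refine le_trans ?_ (finrank_stab_meanderMatrix_le (K := K) hn ha hc)
    rw [← finrank_ker_kirillovForm_add_one hn hp hq]
    exact Nat.add_le_add_right (ciInf_le (OrderBot.bddBelow _) _) 1
  · have h : rotGcd n (p.sizeUpTo 1) (q.sizeUpTo 1) - 1 ≤ lieIndex K (seaweed K p q) := by
      refine le_ciInf fun f => ?_
      obtain ⟨F, rfl⟩ := exists_eq_traceForm f
      have := finrank_ker_kirillovForm_add_one hn hp hq F
      have := rotGcd_le_finrank_stab hn ha hc F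
      omega
    omega

end

/-! ### Counting -/

lemma rotGcd_comm (n a c : ℕ) : rotGcd n a c = rotGcd n c a := by
  unfold rotGcd
  rw [← Int.gcd_neg, neg_sub]

lemma rotGcd_eq_gcd {n a c : ℕ} (ha : a ≤ n) : rotGcd n a c = n.gcd (c + (n - a)) := by
  have h : ((c + (n - a) : ℕ) : ℤ) = (c - a) + n := by
    push_cast [Nat.cast_sub ha]
    ring
  rw [rotGcd, ← Int.gcd_natCast_natCast n, h, Int.gcd_add_self_right]

/-- In each row of the table of the numbers `gcd(n, c - a)`, `0 ≤ a, c < n`, the value `d` occurs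
`φ(n / d)` times. -/
lemma card_rotGcd_eq {n a d : ℕ} (ha : a ≤ n) (hd : d ∣ n) :
    ((Finset.range n).filter fun c => rotGcd n a c = d).card = Nat.totient (n / d) := by
  have hper : Function.Periodic (fun m => n.gcd m = d) n := by
    intro m
    simp
  have hcount := Nat.filter_Ico_card_eq_of_periodic (n - a) n (fun m => n.gcd m = d) hper
  rw [Nat.count_eq_card_filter_range] at hcount
  rw [Nat.totient_div_of_dvd hd, ← hcount]
  refine Finset.card_bij' (fun c _ => c + (n - a)) (fun m _ => m - (n - a)) ?_ ?_ ?_ ?_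
  · intro c hc
    rw [Finset.mem_filter, Finset.mem_range, rotGcd_eq_gcd ha] at hc
    rw [Finset.mem_filter, Finset.mem_Ico]
    exact ⟨by omega, hc.2⟩
  · intro m hm
    rw [Finset.mem_filter, Finset.mem_Ico] at hm
    rw [Finset.mem_filter, Finset.mem_range, rotGcd_eq_gcd ha, Nat.sub_add_cancel hm.1.1]
    exact ⟨by omega, hm.2⟩
  · intro c _
    omega
  · intro m hm
    rw [Finset.mem_filter, Finset.mem_Ico] at hm
    omega

/-- Counting the pairs `0 < a, c < n` by inclusion-exclusion in the table of all pairs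
`0 ≤ a, c < n`. -/
lemma card_rotGcd_pairs_add {n d : ℕ} (hn : 0 < n) (hd : d ∣ n) :
    ((Finset.Ico 1 n ×ˢ Finset.Ico 1 n).filter fun p => rotGcd n p.1 p.2 = d).card +
      2 * Nat.totient (n / d) = n * Nat.totient (n / d) + if n = d then 1 else 0 := by
  have hrow : ∀ a ≤ n, ∑ c ∈ Finset.range n, (if rotGcd n a c = d then 1 else 0) =
      Nat.totient (n / d) := by
    intro a ha
    rw [← card_rotGcd_eq ha hd, Finset.card_filter]
  have hcol : ∑ a ∈ Finset.range n, (if rotGcd n a 0 = d then 1 else 0) = Nat.totient (n / d) := by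
    rw [← hrow 0 hn.le]
    exact Finset.sum_congr rfl fun a _ => by rw [rotGcd_comm]
  have htot : ∑ a ∈ Finset.range n, ∑ c ∈ Finset.range n, (if rotGcd n a c = d then 1 else 0) =
      n * Nat.totient (n / d) := by
    rw [Finset.sum_congr rfl fun a ha => hrow a (Finset.mem_range.1 ha).le, Finset.sum_const,
      Finset.card_range, smul_eq_mul]
  have h00 : rotGcd n 0 0 = n := by simp [rotGcd]
  have hcard : ((Finset.Ico 1 n ×ˢ Finset.Ico 1 n).filter fun p => rotGcd n p.1 p.2 = d).card =
      ∑ a ∈ Finset.Ico 1 n, ∑ c ∈ Finset.Ico 1 n, (if rotGcd n a c = d then 1 else 0) := by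
    rw [Finset.card_filter, Finset.sum_product]
  have hrow0 := hrow 0 hn.le
  rw [Finset.sum_range_eq_add_Ico _ hn, h00] at hrow0 hcol
  rw [Finset.sum_range_eq_add_Ico _ hn, hrow 0 hn.le] at htot
  simp only [Finset.sum_range_eq_add_Ico _ hn, Finset.sum_add_distrib] at htot
  rw [hcard]
  omega

lemma blocks_eq_of_length_two {n : ℕ} {p : Composition n} (hp : p.length = 2) :
    p.blocks = [p.sizeUpTo 1, n - p.sizeUpTo 1] ∧ 0 < p.sizeUpTo 1 ∧ p.sizeUpTo 1 < n := by
  obtain ⟨x, y, hxy⟩ := List.length_eq_two.1 hp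
  have hsum : x + y = n := by
    have := p.blocks_sum
    simpa [hxy] using this
  have hx : 0 < x := p.blocks_pos (by simp [hxy])
  have hy : 0 < y := p.blocks_pos (by simp [hxy])
  have h1 : p.sizeUpTo 1 = x := by simp [Composition.sizeUpTo, hxy]
  rw [h1, hxy]
  refine ⟨?_, hx, by omega⟩
  congr 2
  omega

lemma exists_composition_sizeUpTo_one {n a : ℕ} (ha : 0 < a) (han : a < n) :
    ∃ p : Composition n, p.length = 2 ∧ p.sizeUpTo 1 = a := by
  refine ⟨⟨[a, n - a], ?_, ?_⟩, rfl, ?_⟩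
  · intro i hi
    simp only [List.mem_cons, List.not_mem_nil, or_false] at hi
    omega
  · simp only [List.sum_cons, List.sum_nil]
    omega
  · simp [Composition.sizeUpTo]

lemma seaweedCount22_eq_card (K : Type*) [Field K] [CharZero K] {n : ℕ} (hn : 0 < n) (k : ℕ) :
    seaweedCount22 K n k =
      ((Finset.Ico 1 n ×ˢ Finset.Ico 1 n).filter fun p => rotGcd n p.1 p.2 = k + 1).card := by
  rw [seaweedCount22, ← Set.ncard_coe_finset]
  refine Set.ncard_congr (fun p _ => (p.1.sizeUpTo 1, p.2.sizeUpTo 1)) ?_ ?_ ?_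
  · rintro ⟨p, q⟩ ⟨hp, hq, hk⟩
    have h := lieIndex_seaweed_add_one (K := K) hn hp hq
    rw [hk] at h
    have h1 := blocks_eq_of_length_two hp
    have h2 := blocks_eq_of_length_two hq
    simp only [Finset.coe_filter, Finset.mem_product, Finset.mem_Ico, Set.mem_ofPred_eq]
    exact ⟨⟨h1.2, h2.2⟩, h.symm⟩
  · rintro ⟨p, q⟩ ⟨p', q'⟩ ⟨hp, hq, -⟩ ⟨hp', hq', -⟩ heq
    rw [Prod.mk.injEq] at heq ⊢
    constructor
    · apply Composition.ext
      rw [(blocks_eq_of_length_two hp).1, (blocks_eq_of_length_two hp').1, heq.1]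
    · apply Composition.ext
      rw [(blocks_eq_of_length_two hq).1, (blocks_eq_of_length_two hq').1, heq.2]
  · rintro ⟨a, c⟩ h
    simp only [Finset.coe_filter, Finset.mem_product, Finset.mem_Ico, Set.mem_ofPred_eq] at h
    obtain ⟨⟨ha, hc⟩, hg⟩ := h
    obtain ⟨p, hp, rfl⟩ := exists_composition_sizeUpTo_one ha.1 ha.2
    obtain ⟨q, hq, rfl⟩ := exists_composition_sizeUpTo_one hc.1 hc.2
    refine ⟨(p, q), ⟨hp, hq, ?_⟩, rfl⟩
    have h := lieIndex_seaweed_add_one (K := K) hn hp hq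
    change lieIndex K (seaweed K p q) = k
    omega

theorem mainTheorem7 (K : Type*) [Field K] [IsAlgClosed K] [CharZero K] (t k : ℕ) :
    (1 < t → seaweedCount22 K (t + t * k) k = (t + t * k - 2) * Nat.totient t) ∧
    (t = 1 → seaweedCount22 K (t + t * k) k = t + t * k - 1) := by
  have hdvd : k + 1 ∣ t + t * k := ⟨t, by ring⟩
  have hdiv : (t + t * k) / (k + 1) = t := by
    rw [show t + t * k = t * (k + 1) by ring, Nat.mul_div_cancel _ (Nat.succ_pos k)]
  constructor
  · intro ht
    have h := card_rotGcd_pairs_add (n := t + t * k) (by omega) hdvd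
    have hne : t + t * k ≠ k + 1 := by
      rw [show t + t * k = t * (k + 1) by ring]
      intro h0
      nlinarith
    rw [hdiv, if_neg hne] at h
    rw [seaweedCount22_eq_card K (by omega), Nat.sub_mul]
    omega
  · rintro rfl
    have h := card_rotGcd_pairs_add (n := 1 + 1 * k) (by omega) hdvd
    rw [hdiv, if_pos (by ring), Nat.totient_one] at h
    rw [seaweedCount22_eq_card K (by omega)]
    omega
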